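/- **Setting.** Let $Z$ be a bounded doubling metric space with at least two points and with finite capacity dimension $n=\operatorname{cdim}Z$. Here, for a family $\mathcal U=\bigcup_{c\in C}\mathcal U^c$ of open sets covering $Z$, each $\mathcal U^c$ consisting of pairwise disjoint sets (an *open covering colored by $C$*), one puts $\operatorname{mesh}\mathcal U=\sup_{U\in\mathcal U}\operatorname{diam}U$ and $L(\mathcal U)=\inf_{z\in Z}\min\{\sup_{U\in\mathcal U}\operatorname{dist}(z,Z\setminus U),\operatorname{mesh}\mathcal U\}$ (with $\operatorname{dist}(z,\emptyset)=\infty$), and $\operatorname{cdim}Z$ is the least integer $m\ge 0$ for which there is $\delta>0$ such that for all sufficiently small $\tau>0$ there is an open covering $\mathcal U$ of $Z$ colored by $m+1$ colors with $\operatorname{mesh}\mathcal U\le\tau$ and $L(\mathcal U)\ge\delta\tau$. Let $C$ be a set with $|C|=n+1$. *Hyperbolic approximation.* Let $0<r\le 1/6$, and let $k_0$ be the largest integer with $\operatorname{diam}Z<r^{k_0}$. For every integer $k\ge k_0$ let $V_k\subset Z$ be a maximal $r^k$-separated set (distinct points have distance $\ge r^k$), let $V$ be the disjoint union of the $V_k$,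 and for $v\in V_k$ put $\ell(v)=k$ and let $B(v)$ be the open ball of radius $2r^k$ about $v$. The hyperbolic approximation $X$ is the graph with vertex set $V$ in which distinct vertices of the same level are adjacent iff their closed balls (of the same radii) intersect, and vertices $v\in V_k$, $v'\in V_{k+1}$ are adjacent iff $B(v')\subset B(v)$. $V$ carries the path metric of $X$. *Adapted coverings.* A sequence $\mathcal U_j$, $j\ge 0$, of open coverings of $Z$ by nonempty sets, colored by $C$, is *adapted* to $X$ if $r<\min\{\operatorname{diam}Z,1/\operatorname{diam}Z\}$ (so $k_0\in\{0,-1\}$) and (1) $\mathcal U_0^c=\{Z\}$ for all $c\in C$, and $\operatorname{mesh}\mathcal U_j<r^j$ for $j\ge1$; (2) for every $v\in V_{j+1}$, $j\ge0$, there is $U\in\mathcal U_j$ with $B(v)\subset U$; (3) for every $c\in C$ and all different members $U\in\mathcal U_j^c$, $U'\in\mathcal U_{j'}^c$ with $j'\le j$ (members with $j\neq j'$ count as different), the union $B(U)$ of all $B(v)$ with $v\in V_{j+1}$, $B(v)\cap U\ne\emptyset$ satisfies $B(U)\subset U'$ or $B(U)\cap U'=\emptyset$. *Colored trees.* The vertex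 set of the rooted tree $T_c$ is the disjoint union $\bigcup_{j\ge0}\mathcal U_j^c$. The root $Z\in\mathcal U_0^c$ has level $k_0$, and $U\in\mathcal U_j^c$, $j\ge1$, has level $\ell(U)=j$. A vertex $U'$ is an ancestor of $U$ if $\ell(U')<\ell(U)$ and $U\subset U'$, and every $U$ other than the root is joined by an edge to its ancestor of maximal level. The map $f_c:V\to T_c$ sends the vertex in $V_{k_0}$ to the root, and $v$ with $\ell(v)>k_0$ to the vertex $U$ of maximal level among those with $B(v)\subset U$ and $\ell(U)\le\ell(v)-1$. Put $f=(f_c)_{c\in C}:V\to\prod_cT_c$. *Labelling.* Let $F$ be a finite set and let $\mu_j:V_j\to F$, $j\ge k_0$, satisfy $\mu_j(v)\ne\mu_j(v')$ for distinct $v,v'\in V_j$ with $d(v,v')<2r^{j-2}$. Let $A'$ be the set of nonempty subsets of $F$, let $s$ be an additional symbol (the stop sign), and let $t(0),t(1),\dots$ be the Morse–Thue sequence. To the edge between $U$ and its ancestor $U'$ associate the word whose letters, for $k=\ell(U')+1,\dots,\ell(U)$, are $(a_k',t(k))$ with $a'_k=\{\mu_{k+1}(v): v\in V_{k+1},\ B(v)\cap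 U\neq\emptyset\}\in A'$, followed by the stop sign $(s,t(\ell(U)))$. Reading these along the path from the root to $U$ gives the decorated sentence $\alpha(U)$, whose symbols lie in $(A'\cup\{s\})\times\{0,1\}$. *Diary.* Let $\kappa\ge1$ and let $\Omega$ be the finite set of pages: a page is a word of exactly $\kappa$ symbols from $(A'\cup\{s\})\times\{0,1\}$, or a word of fewer than $\kappa$ such symbols concluded by $\star$. The diary of a sentence with $m$ words has $m$ pages, written successively. The $i$-th page lists, backward, the last $\kappa$ symbols preceding the $i$-th stop sign which are not listed on earlier pages; if fewer than $\kappa$ such symbols are left, it lists all of them and ends with $\star$. Let $T_\Omega$ be the tree of finite words in $\Omega$ (two words are adjacent iff one arises from the other by erasing the last letter), let $\psi_c:T_c\to T_\Omega$ map $U$ to the diary of $\alpha(U)$, and put $\psi=\prod_c\psi_c:\prod_cT_c\to T_\Omega^{|C|}$. The product $T_\Omega^{|C|}$ carries the $\ell_1$ product of the path metrics. **Theorem.** (a) For all sufficiently small $r>0$, hyperbolic approximations of $Z$ with parameter $r$ exist, there is a sequence of open coverings of $Z$ colored by $C$ which is adapted to every hyperbolic approximation of $Z$ with parameter $r$, and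 there is a finite set $F$ such that every hyperbolic approximation with parameter $r$ admits maps $\mu_j:V_j\to F$ as above. (b) For every hyperbolic approximation $X$ of $Z$, every sequence of open coverings colored by $C$ adapted to $X$, every finite set $F$ with maps $\mu_j$ as above, and every $\kappa\ge 15|C|+1$: $X$ is connected, $T_\Omega$ is a tree all of whose vertices have finite valence, and the composition $\psi\circ f:V\to T_\Omega^{|C|}$ is a quasi-isometric embedding, i.e. there are $a_1,a_2>0$ and $b\ge0$ with $$a_1|vv'|-b\le|\psi f(v)\,\psi f(v')|\le a_2|vv'|+b\qquad\text{for all }v,v'\in V.$$ -/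

import Mathlib

open Set
open scoped ENNReal

namespace AliceDiary

noncomputable section

/-! ### Metric notions -/

/-- Every ball can be covered by at most `N` balls of half the radius. -/
def IsDoubling (Z : Type*) [MetricSpace Z] : Prop :=
  ∃ N : ℕ, ∀ (x : Z) (ρ : ℝ), 0 < ρ →
    ∃ s : Finset Z, s.card ≤ N ∧ Metric.ball x ρ ⊆ ⋃ y ∈ s, Metric.ball y (ρ / 2)

/-- A map is quasi-isometric (a quasi-isometric embedding) with respect to the distance functions
`dX` and `dY`. -/
def IsQuasiIsometric {X Y : Type*} (dX : X → X → ℝ) (dY : Y → Y → ℝ) (f : X → Y) : Prop :=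
  ∃ a₁ a₂ b : ℝ, 0 < a₁ ∧ 0 < a₂ ∧ 0 ≤ b ∧
    ∀ x x' : X, a₁ * dX x x' - b ≤ dY (f x) (f x') ∧ dY (f x) (f x') ≤ a₂ * dX x x' + b

/-! ### Colored coverings and capacity dimension -/

/-- `𝒰 c` is the family of the members of color `c`. Each family is disjoint, all members are open,
and together they cover `Z`. The same set may occur in several colors. -/
structure IsColoredOpenCover {Z C : Type*} [MetricSpace Z] (𝒰 : C → Set (Set Z)) : Prop where
  isOpen : ∀ c, ∀ U ∈ 𝒰 c, IsOpen U
  disjoint : ∀ c, (𝒰 c).PairwiseDisjoint id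
  cover : ⋃ c, ⋃₀ 𝒰 c = univ

/-- The supremum of the diameters of the members. -/
def mesh {Z C : Type*} [MetricSpace Z] (𝒰 : C → Set (Set Z)) : ℝ≥0∞ :=
  ⨆ c, ⨆ U ∈ 𝒰 c, Metric.ediam U

/-- The Lebesgue number `inf_z min (sup_U dist (z, Z \ U), mesh)`;
the distance to the empty set is `∞`. -/
def lebesgueNumber {Z C : Type*} [MetricSpace Z] (𝒰 : C → Set (Set Z)) : ℝ≥0∞ :=
  ⨅ z : Z, min (⨆ c, ⨆ U ∈ 𝒰 c, Metric.infEDist z Uᶜ) (mesh 𝒰)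

/-- The property whose minimal `m` is the capacity dimension. -/
def CapacityProperty (Z : Type*) [MetricSpace Z] (m : ℕ) : Prop :=
  ∃ δ : ℝ, 0 < δ ∧ ∃ τ₀ : ℝ, 0 < τ₀ ∧ ∀ τ : ℝ, 0 < τ → τ < τ₀ →
    ∃ 𝒰 : Fin (m + 1) → Set (Set Z), IsColoredOpenCover 𝒰 ∧
      mesh 𝒰 ≤ ENNReal.ofReal τ ∧ ENNReal.ofReal (δ * τ) ≤ lebesgueNumber 𝒰

/-- The capacity dimension (`⊤` if no `m` has the required property). -/
def cdim (Z : Type*) [MetricSpace Z] : ℕ∞ :=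
  ⨅ m ∈ {m : ℕ | CapacityProperty Z m}, (m : ℕ∞)

/-! ### Hyperbolic approximations -/

/-- Distinct points of `S` have distance at least `a`. -/
def IsSep {Z : Type*} [MetricSpace Z] (a : ℝ) (S : Set Z) : Prop :=
  S.Pairwise fun x y => a ≤ dist x y

/-- The data of a hyperbolic approximation of `Z` with parameter `r`: a maximal `r ^ k`-separated
set `net k` for every integer `k ≥ k₀`, where `k₀` is the largest integer with
`diam Z < r ^ k₀`. -/
structure HypApprox (Z : Type*) [MetricSpace Z] (r : ℝ) where
  r_pos : 0 < r
  r_le : r ≤ 1 / 6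
  k₀ : ℤ
  isGreatest_k₀ : IsGreatest {k : ℤ | Metric.diam (univ : Set Z) < r ^ k} k₀
  net : ℤ → Set Z
  maximal_net : ∀ k, k₀ ≤ k → Maximal (IsSep (r ^ k)) (net k)

namespace HypApprox

variable {Z : Type*} [MetricSpace Z] {r : ℝ}

/-- Vertices: the disjoint union of the nets, as pairs (level, point). -/
def Vertex (X : HypApprox Z r) : Type _ :=
  {p : ℤ × Z // X.k₀ ≤ p.1 ∧ p.2 ∈ X.net p.1}

variable {X : HypApprox Z r}

def Vertex.level (v : X.Vertex) : ℤ := v.1.1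

def Vertex.point (v : X.Vertex) : Z := v.1.2

/-- The ball `B(v)`. -/
def Vertex.ball (v : X.Vertex) : Set Z := Metric.ball v.point (2 * r ^ v.level)

def Vertex.closedBall (v : X.Vertex) : Set Z := Metric.closedBall v.point (2 * r ^ v.level)

/-- Horizontal edges join vertices of one level whose closed balls meet; radial edges join vertices
of neighboring levels such that the ball of the upper level lies in the ball of the lower one. -/
def graph (X : HypApprox Z r) : SimpleGraph X.Vertex where
  Adj v w := v ≠ w ∧
    ((v.level = w.level ∧ (v.closedBall ∩ w.closedBall).Nonempty) ∨
      (w.level = v.level + 1 ∧ w.ball ⊆ v.ball) ∨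
      (v.level = w.level + 1 ∧ v.ball ⊆ w.ball))
  symm := ⟨fun v w h => ⟨h.1.symm, by
    rcases h.2 with ⟨h1, h2⟩ | h1 | h1
    · exact Or.inl ⟨h1.symm, by rwa [inter_comm]⟩
    · exact Or.inr (Or.inr h1)
    · exact Or.inr (Or.inl h1)⟩⟩
  loopless := ⟨fun v h => h.1 rfl⟩

/-- The path metric on the vertex set. -/
def vdist (X : HypApprox Z r) (v w : X.Vertex) : ℝ := (X.graph.dist v w : ℝ)

/-- The set `B(U)` for a covering element `U` of level `j`: the union of the balls `B(v)`, `v` of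
level `j + 1`, which meet `U`. -/
def hull (X : HypApprox Z r) (j : ℕ) (U : Set Z) : Set Z :=
  ⋃ v ∈ {v : X.Vertex | v.level = (j : ℤ) + 1 ∧ (v.ball ∩ U).Nonempty}, v.ball

/-- Vertices of one level `j` at distance `< 2 r ^ (j - 2)` in `Z` get different colors. -/
def IsProperColoring (X : HypApprox Z r) {F : Type*} (μ : X.Vertex → F) : Prop :=
  ∀ v w : X.Vertex, v ≠ w → v.level = w.level →
    dist v.point w.point < 2 * r ^ (v.level - 2) → μ v ≠ μ w

end HypApprox

/-- A sequence of colored open coverings of `Z`, `𝒰 j c` being the members of level `j` and of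
color `c`, which is adapted to the hyperbolic approximation `X`. Members of different levels are
considered as different even if they are equal as sets. -/
structure IsAdapted {Z C : Type*} [MetricSpace Z] {r : ℝ} (X : HypApprox Z r)
    (𝒰 : ℕ → C → Set (Set Z)) : Prop where
  r_lt : r < min (Metric.diam (univ : Set Z)) (1 / Metric.diam (univ : Set Z))
  isCover : ∀ j, IsColoredOpenCover (𝒰 j)
  nonempty : ∀ j c, ∀ U ∈ 𝒰 j c, U.Nonempty
  zero : ∀ c, 𝒰 0 c = {univ}
  mesh_lt : ∀ j, 1 ≤ j → mesh (𝒰 j) < ENNReal.ofReal (r ^ j)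
  ball_subset : ∀ (j : ℕ) (v : X.Vertex), v.level = (j : ℤ) + 1 →
    ∃ c, ∃ U ∈ 𝒰 j c, v.ball ⊆ U
  separation : ∀ (c : C) (j j' : ℕ) (U U' : Set Z), U ∈ 𝒰 j c → U' ∈ 𝒰 j' c → j' ≤ j →
    (j, U) ≠ (j', U') → X.hull j U ⊆ U' ∨ X.hull j U ∩ U' = ∅

/-! ### The tree of words -/

/-- The tree `T_Ω` of finite words in `Ω`; two words are adjacent iff one is obtained from the
other by erasing the last letter. -/
def wordTree (Ω : Type*) : SimpleGraph (List Ω) where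
  Adj w w' := (∃ a, w' = w ++ [a]) ∨ (∃ a, w = w' ++ [a])
  symm := ⟨fun _ _ h => h.symm⟩
  loopless := ⟨fun w h => by rcases h with ⟨a, h⟩ | ⟨a, h⟩ <;> simp at h⟩

/-- The `ℓ₁` product metric on a finite power of `T_Ω`. -/
def prodDist {C Ω : Type*} [Fintype C] (x y : C → List Ω) : ℝ :=
  ∑ c, ((wordTree Ω).dist (x c) (y c) : ℝ)

/-! ### The diary -/

/-- The pages: words of precisely `κ` letters, or words of fewer than `κ` letters (understood as
concluded by the symbol `⋆`). -/
abbrev Page (κ : ℕ) (L : Type*) : Type _ :=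
  List.Vector L κ ⊕ (Σ n : Fin κ, List.Vector L n)

/-- The page written when `l` lists the days not yet described, the most recent one first. -/
def writePage {L : Type*} (κ : ℕ) (l : List L) : Page κ L :=
  if h : κ ≤ l.length then
    Sum.inl ⟨l.take κ, by simp [h]⟩
  else
    Sum.inr ⟨⟨l.length, by omega⟩, ⟨l, rfl⟩⟩

/-- The diary of a sentence, given as the list of its words, each one together with the stop sign
that terminates it. `rest` lists the days not yet described, the most recent one first. A page is
written before the stop sign of its own day is added to `rest`. -/
def diaryFrom {L : Type*} (κ : ℕ) : List L → List (List L × L) → List (Page κ L)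
  | _, [] => []
  | rest, (w, s) :: α =>
      writePage κ (w.reverse ++ rest) ::
        diaryFrom κ (s :: (w.reverse ++ rest).drop κ) α

def diary {L : Type*} (κ : ℕ) (α : List (List L × L)) : List (Page κ L) :=
  diaryFrom κ [] α

/-! ### The Morse-Thue sequence -/

/-- The words obtained from `0` by iterating the substitution `0 → 01`, `1 → 10`. -/
def morseThueWord : ℕ → List Bool
  | 0 => [false]
  | k + 1 => (morseThueWord k).flatMap fun b => [b, !b]

/-- The Morse-Thue sequence, i.e. the limit of the nested words `morseThueWord k` (which have
`2 ^ k` letters, so that the letter of index `n` can be read off from the `n`-th word). -/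
def morseThue (n : ℕ) : Bool := (morseThueWord n).getD n false

/-! ### Colored trees -/

/-- The vertices of the tree `T_c`, as pairs (index of the covering, covering element). -/
def TreeVertex {Z C : Type*} (𝒰 : ℕ → C → Set (Set Z)) (c : C) : Type _ :=
  {p : ℕ × Set Z // p.2 ∈ 𝒰 p.1 c}

namespace TreeVertex

variable {Z C : Type*} {𝒰 : ℕ → C → Set (Set Z)} {c : C}

def index (U : TreeVertex 𝒰 c) : ℕ := U.1.1

def carrier (U : TreeVertex 𝒰 c) : Set Z := U.1.2

/-- `U'` is an ancestor of `U`. -/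
def IsAncestor (U' U : TreeVertex 𝒰 c) : Prop :=
  U'.index < U.index ∧ U.carrier ⊆ U'.carrier

/-- `U'` and `U` form an edge of `T_c` in which `U'` is the ancestor: it is the ancestor of `U` of
maximal level. -/
def IsParent (U' U : TreeVertex 𝒰 c) : Prop :=
  IsAncestor U' U ∧ ∀ U'' : TreeVertex 𝒰 c, IsAncestor U'' U → U''.index ≤ U'.index

/-- The level of a vertex of `T_c`. The root has the same level `k₀` as the root of the hyperbolic
approximation (so level `0` if `diam Z < 1`), any other vertex has the index of its covering. -/
def level (k₀ : ℤ) (U : TreeVertex 𝒰 c) : ℤ := if U.index = 0 then k₀ else U.index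

end TreeVertex

namespace HypApprox

variable {Z : Type*} [MetricSpace Z] {r : ℝ}

/-- Every point has distance `≤ r ^ k` to some vertex of level `k`, so it lies in its ball. -/
theorem exists_mem_ball (X : HypApprox Z r) (z : Z) (k : ℤ) (hk : X.k₀ ≤ k) :
    ∃ v : X.Vertex, v.level = k ∧ z ∈ v.ball := by
  have hr : 0 < r ^ k := zpow_pos X.r_pos k
  by_contra! hcon
  have hfar : ∀ x ∈ X.net k, r ^ k ≤ dist z x := by
    intro x hx
    have := hcon ⟨(k, x), hk, hx⟩ rfl
    simp only [Vertex.ball, Vertex.point, Vertex.level, Metric.mem_ball, not_lt] at this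
    linarith
  have hz : z ∉ X.net k := fun h => by
    have := hfar z h
    rw [dist_self] at this
    linarith
  have hsep : IsSep (r ^ k) (insert z (X.net k)) := by
    refine (X.maximal_net k hk).prop.insert ?_
    intro x hx _
    exact ⟨hfar x hx, by rw [dist_comm]; exact hfar x hx⟩
  exact hz ((X.maximal_net k hk).le_of_ge hsep (subset_insert _ _) (mem_insert _ _))

end HypApprox

namespace IsAdapted

variable {Z C : Type*} [MetricSpace Z] {r : ℝ} {X : HypApprox Z r} {𝒰 : ℕ → C → Set (Set Z)}

/-- The root `Z` of `T_c`. -/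
def root (h : IsAdapted X 𝒰) (c : C) : TreeVertex 𝒰 c :=
  ⟨(0, univ), by simp [h.zero c]⟩

theorem k₀_nonpos (h : IsAdapted X 𝒰) : X.k₀ ≤ 0 := by
  by_contra! hk
  have h1 : Metric.diam (univ : Set Z) < r ^ X.k₀ := X.isGreatest_k₀.1
  have h2 : r ^ X.k₀ ≤ r ^ (1 : ℤ) :=
    zpow_le_zpow_right_of_le_one₀ X.r_pos (by linarith [X.r_le]) (by omega)
  have h3 := lt_min_iff.1 h.r_lt
  rw [zpow_one] at h2
  linarith [h3.1]

theorem k₀_le_level (h : IsAdapted X 𝒰) {c : C} (U : TreeVertex 𝒰 c) :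
    X.k₀ ≤ U.level X.k₀ := by
  unfold TreeVertex.level
  have := h.k₀_nonpos
  split_ifs <;> omega

theorem exists_parent (h : IsAdapted X 𝒰) {c : C} (U : TreeVertex 𝒰 c) (hU : U.index ≠ 0) :
    ∃ U' : TreeVertex 𝒰 c, U'.IsParent U := by
  classical
  let P : ℕ → Prop := fun i => ∃ U' : TreeVertex 𝒰 c, U'.IsAncestor U ∧ U'.index = i
  have h0 : P 0 := ⟨h.root c, ⟨Nat.pos_of_ne_zero hU, subset_univ _⟩, rfl⟩
  obtain ⟨U', hU', hi⟩ := Nat.findGreatest_spec (P := P) (Nat.zero_le U.index) h0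
  refine ⟨U', hU', fun U'' hU'' => ?_⟩
  rw [hi]
  exact Nat.le_findGreatest hU''.1.le ⟨U'', hU'', rfl⟩

/-- The neighbor of `U` (not the root) on the way to the root. -/
def parent (h : IsAdapted X 𝒰) {c : C} (U : TreeVertex 𝒰 c) (hU : U.index ≠ 0) :
    TreeVertex 𝒰 c :=
  (h.exists_parent U hU).choose

theorem parent_spec (h : IsAdapted X 𝒰) {c : C} (U : TreeVertex 𝒰 c) (hU : U.index ≠ 0) :
    (h.parent U hU).IsParent U :=
  (h.exists_parent U hU).choose_spec

/-! ### The map into the product of colored trees -/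

/-- `U` contains the ball `B(v)`, its level is at most `ℓ(v) - 1`, and is maximal with this
property. -/
def IsImage {c : C} (v : X.Vertex) (U : TreeVertex 𝒰 c) : Prop :=
  (v.ball ⊆ U.carrier ∧ U.level X.k₀ ≤ v.level - 1) ∧
    ∀ U' : TreeVertex 𝒰 c, v.ball ⊆ U'.carrier → U'.level X.k₀ ≤ v.level - 1 →
      U'.level X.k₀ ≤ U.level X.k₀

theorem exists_isImage (h : IsAdapted X 𝒰) (c : C) (v : X.Vertex) (hv : v.level ≠ X.k₀) :
    ∃ U : TreeVertex 𝒰 c, IsImage v U := by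
  have hlt : X.k₀ < v.level := lt_of_le_of_ne v.2.1 (Ne.symm hv)
  obtain ⟨m, ⟨U, h1, h2, h3⟩, hm⟩ := Int.exists_greatest_of_bdd
    (P := fun i => ∃ U : TreeVertex 𝒰 c,
      v.ball ⊆ U.carrier ∧ U.level X.k₀ ≤ v.level - 1 ∧ U.level X.k₀ = i)
    ⟨v.level - 1, fun _ ⟨_, _, h2, h3⟩ => h3 ▸ h2⟩
    ⟨X.k₀, h.root c, subset_univ _, by simp [TreeVertex.level, root, TreeVertex.index]; omega,
      by simp [TreeVertex.level, root, TreeVertex.index]⟩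
  exact ⟨U, ⟨h1, h2⟩, fun U' h1' h2' => h3 ▸ hm _ ⟨U', h1', h2', rfl⟩⟩

open Classical in
/-- The map `f_c : V → T_c`. -/
def colorMap (h : IsAdapted X 𝒰) (c : C) (v : X.Vertex) : TreeVertex 𝒰 c :=
  if hv : v.level = X.k₀ then h.root c else (h.exists_isImage c v hv).choose

/-- The product map `f : V → ∏ T_c`. -/
def prodMap (h : IsAdapted X 𝒰) (v : X.Vertex) : ∀ c, TreeVertex 𝒰 c := fun c => h.colorMap c v

end IsAdapted

/-! ### Labelling and the diary maps -/

/-- The alphabet `A'` of the nonempty subsets of `F`. -/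
abbrev SubsetLetter (F : Type*) : Type _ := {s : Set F // s.Nonempty}

/-- The decorated letters: letters of `A'` or the stop sign (`none`), with a decoration from
`{0, 1}`. -/
abbrev Letter (F : Type*) : Type _ := Option (SubsetLetter F) × Bool

namespace IsAdapted

variable {Z C : Type*} [MetricSpace Z] {r : ℝ} {X : HypApprox Z r} {𝒰 : ℕ → C → Set (Set Z)}
  {F : Type*}

/-- The set of the colors `μ v` of the vertices `v` of level `k + 1` whose balls meet `U`. -/
def colorSet (h : IsAdapted X 𝒰) (μ : X.Vertex → F) {c : C} (U : TreeVertex 𝒰 c) (k : ℤ)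
    (hk : X.k₀ ≤ k) : SubsetLetter F :=
  ⟨{a | ∃ v : X.Vertex, v.level = k + 1 ∧ (v.ball ∩ U.carrier).Nonempty ∧ μ v = a}, by
    obtain ⟨z, hz⟩ := h.nonempty _ _ _ U.2
    obtain ⟨v, hv, hzv⟩ := X.exists_mem_ball z (k + 1) (by omega)
    exact ⟨μ v, v, hv, ⟨z, hzv, hz⟩, rfl⟩⟩

/-- The word attached to the edge between `U` and its ancestor `U'`: one decorated letter for each
level `k` with `ℓ(U') + 1 ≤ k ≤ ℓ(U)`. -/
def edgeWord (h : IsAdapted X 𝒰) (μ : X.Vertex → F) {c : C} (U' U : TreeVertex 𝒰 c) :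
    List (Letter F) :=
  List.ofFn fun i : Fin (U.level X.k₀ - U'.level X.k₀).toNat =>
    (some (h.colorSet μ U (U'.level X.k₀ + 1 + (i : ℤ)) (by
        have := h.k₀_le_level U'
        omega)),
      morseThue (U'.level X.k₀ + 1 + (i : ℤ)).toNat)

/-- The stop sign terminating the last word of the sentence of `U`; its level is the level of the
last letter of this word, that is `ℓ(U)`. -/
def stopSign (X : HypApprox Z r) (F : Type*) {c : C} (U : TreeVertex 𝒰 c) : Letter F :=
  (none, morseThue (U.level X.k₀).toNat)

/-- The decorated sentence `α(U)`: the words, with their stop signs, attached to the consecutive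
edges of the path in `T_c` from the root to `U`. -/
def sentence (h : IsAdapted X 𝒰) (μ : X.Vertex → F) {c : C} (U : TreeVertex 𝒰 c) :
    List (List (Letter F) × Letter F) :=
  if hU : U.index = 0 then []
  else h.sentence μ (h.parent U hU) ++
    [(h.edgeWord μ (h.parent U hU) U, stopSign X F U)]
termination_by U.index
decreasing_by exact (h.parent_spec U hU).1.1

/-- The product `ψ : ∏ T_c → T_Ω ^ C` of the diary maps `ψ_c : T_c → T_Ω`, where `Ω` is the finite
set of decorated pages. -/
def prodDiary (h : IsAdapted X 𝒰) (μ : X.Vertex → F) (κ : ℕ) (U : ∀ c, TreeVertex 𝒰 c) :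
    C → List (Page κ (Letter F)) :=
  fun c => diary κ (h.sentence μ (U c))

end IsAdapted

end

end AliceDiary

open AliceDiary

namespace AliceDiary

/-! ### The Morse-Thue sequence has no cubes -/

/-! Let `l` be the largest level, not above those of `v` and `v'`, at which the two points have
distance at most `5/3 * r ^ l`. Going down to level `l - 1`, across and up again gives `|vv'| ≤ ℓ(v)
+ ℓ(v') - 2l + 3` (`dist_le_of_dist_point_le`). With `v` the higher vertex, the lower bound
therefore asks that `ℓ(v) - l` be bounded linearly by the distance of the diaries. The upper bound
is local: along a radial edge every path to the root grows by at most two vertices, and each vertex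
is one page (`diary_dist_le_of_ball_subset`).

For the lower bound, let the paths of `v` and `v'` in color `c` share `q c` vertices. These have
level at most `l`. Every ball lies in a covering element of some color, so each level strictly
between `l` and `ℓ(v)` occurs beyond the shared part in some color (`exists_mem_chain`). It remains
to see that the diaries do not share many more than `q c` pages (`exists_common_bound`).

Suppose that they do. A single page may fail to cover the recent past, because words can be long. If
the page is chosen to maximize `(κ - 1) * i - level`, all final parts of the sentence are short on
the average, and the latest pages together recover a long recent stretch of the text, or all of it
beyond the shared part (`take_text_eq`, `flat_eq_or_take_flat_eq`). On a recovered stretch the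
decorations show that the days in question have the same level, since the Morse-Thue sequence is
cube-free (`eq_of_morseThue_eq`); when all letters are recovered, their number shows it. Then equal
color sets improve the closeness of the two points from one level to the next
(`dist_le_of_colorSet_eq`), up to a level greater than `l`, which contradicts the choice of `l`.
Each color loses about `3 * (ℓ(v) - l) / (κ - 1)` pages, and `κ - 1 ≥ 15 * |C|` makes the total loss
at most a fifth of `ℓ(v) - l`, up to a constant.

Adapted coverings arise from coverings of capacity dimension type: shrinking separates the members
of one color, and each member is then enlarged by all chains of members of higher levels starting in
it (`saturation`). The labels come from greedy coloring and the doubling property. -/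

theorem getElem?_flatMap_pair (l : List Bool) (i : ℕ) :
    (l.flatMap fun b => [b, !b])[2 * i]? = l[i]? ∧
      (l.flatMap fun b => [b, !b])[2 * i + 1]? = l[i]?.map not := by
  induction l generalizing i with
  | nil => simp
  | cons b l ih =>
    cases i with
    | zero => simp
    | succ i =>
      have := ih i
      simpa [Nat.mul_add] using this

theorem length_morseThueWord (k : ℕ) : (morseThueWord k).length = 2 ^ k := by
  induction k with
  | zero => rfl
  | succ k ih => simp [morseThueWord, List.length_flatMap, ih, pow_succ]

theorem getElem?_morseThueWord_succ (k i : ℕ) (h : i < 2 ^ k) :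
    (morseThueWord (k + 1))[i]? = (morseThueWord k)[i]? := by
  induction k generalizing i with
  | zero => obtain rfl : i = 0 := by simpa using h
            rfl
  | succ k ih =>
    have h1 := getElem?_flatMap_pair (morseThueWord (k + 1)) (i / 2)
    have h2 := getElem?_flatMap_pair (morseThueWord k) (i / 2)
    have h3 := ih (i / 2) (by rw [pow_succ] at h; omega)
    rw [h3] at h1
    rw [show morseThueWord (k + 1 + 1) = (morseThueWord (k + 1)).flatMap fun b => [b, !b] from rfl]
    conv_rhs => rw [show morseThueWord (k + 1) = (morseThueWord k).flatMap fun b => [b, !b] from rfl]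
    rcases Nat.even_or_odd' i with ⟨m, rfl | rfl⟩
    · rw [show 2 * m / 2 = m by omega] at h1 h2
      rw [h1.1, h2.1]
    · rw [show (2 * m + 1) / 2 = m by omega] at h1 h2
      rw [h1.2, h2.2]

/-- The words are nested, so any two words long enough to have an `i`-th letter agree there. This
removes the choice of the `n`-th word made in `morseThue` and yields the two doubling rules below.
-/
theorem getElem?_morseThueWord (k i : ℕ) (h : i < 2 ^ k) :
    (morseThueWord k)[i]? = some (morseThue i) := by
  have key : ∀ m, (morseThueWord (m + i))[i]? = (morseThueWord i)[i]? := by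
    intro m
    induction m with
    | zero => simp
    | succ m ih =>
      rw [show m + 1 + i = m + i + 1 by ring, getElem?_morseThueWord_succ, ih]
      exact Nat.lt_two_pow_self.trans_le (Nat.pow_le_pow_right (by norm_num) (by omega))
  have key2 : ∀ m, (morseThueWord (k + m))[i]? = (morseThueWord k)[i]? := by
    intro m
    induction m with
    | zero => simp
    | succ m ih =>
      rw [← add_assoc, getElem?_morseThueWord_succ, ih]
      exact h.trans_le (Nat.pow_le_pow_right (by norm_num) (by omega))
  have h3 : (morseThueWord k)[i]? = (morseThueWord i)[i]? := by
    rw [← key2 i, key k]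
  rw [h3, morseThue, List.getD_eq_getElem?_getD]
  have : i < (morseThueWord i).length := by
    rw [length_morseThueWord]; exact Nat.lt_two_pow_self
  simp [List.getElem?_eq_getElem this]

theorem morseThue_two_mul (n : ℕ) : morseThue (2 * n) = morseThue n := by
  have h1 := (getElem?_flatMap_pair (morseThueWord n) n).1
  rw [getElem?_morseThueWord n n Nat.lt_two_pow_self] at h1
  have h2 := getElem?_morseThueWord (n + 1) (2 * n)
    (by rw [pow_succ]; have := @Nat.lt_two_pow_self n; omega)
  rw [morseThueWord, h1] at h2
  simpa using h2.symm

theorem morseThue_two_mul_add_one (n : ℕ) : morseThue (2 * n + 1) = !morseThue n := by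
  have h1 := (getElem?_flatMap_pair (morseThueWord n) n).2
  rw [getElem?_morseThueWord n n Nat.lt_two_pow_self] at h1
  have h2 := getElem?_morseThueWord (n + 1) (2 * n + 1)
    (by rw [pow_succ]; have := @Nat.lt_two_pow_self n; omega)
  rw [morseThueWord, h1] at h2
  simpa using h2.symm

theorem morseThue_ne_succ_of_even {p : ℕ} (hp : p % 2 = 0) :
    morseThue p ≠ morseThue (p + 1) := by
  obtain ⟨m, rfl⟩ : ∃ m, p = 2 * m := ⟨p / 2, by omega⟩
  rw [morseThue_two_mul, morseThue_two_mul_add_one]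
  simp

theorem morseThue_no_three (a : ℕ) (h1 : morseThue a = morseThue (a + 1))
    (h2 : morseThue (a + 1) = morseThue (a + 2)) : False := by
  rcases Nat.mod_two_eq_zero_or_one a with h | h
  · exact morseThue_ne_succ_of_even h h1
  · exact morseThue_ne_succ_of_even (p := a + 1) (by omega) h2

/-- The Morse-Thue sequence contains no cubes. -/
theorem morseThue_cube_free (s : ℕ) (hs : 0 < s) (a : ℕ)
    (h : ∀ k, a ≤ k → k < a + 2 * s → morseThue k = morseThue (k + s)) : False := by
  induction s using Nat.strong_induction_on generalizing a with
  | _ s ih =>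
    rcases Nat.mod_two_eq_zero_or_one s with hs2 | hs2
    -- For an even shift the even positions alone already carry a repetition with half the shift.
    · obtain ⟨u, rfl⟩ : ∃ u, s = 2 * u := ⟨s / 2, by omega⟩
      refine ih u (by omega) (by omega) ((a + 1) / 2) fun k hk1 hk2 => ?_
      have := h (2 * k) (by omega) (by omega)
      rwa [← mul_add, morseThue_two_mul, morseThue_two_mul] at this
    · by_cases h1 : s = 1
      · subst h1
        exact morseThue_no_three a (h a le_rfl (by omega)) (h (a + 1) (by omega) (by omega))
      -- An odd shift carries a pair starting at an odd position to one starting at an even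
      -- position, and the latter has different letters. So the letters alternate on the last two
      -- periods.
      · have alt : ∀ p, a + s ≤ p → p + 1 < a + 3 * s → morseThue p ≠ morseThue (p + 1) := by
          intro p hp1 hp2
          rcases Nat.mod_two_eq_zero_or_one p with hp | hp
          · exact morseThue_ne_succ_of_even hp
          · have e1 := h (p - s) (by omega) (by omega)
            have e2 := h (p - s + 1) (by omega) (by omega)
            rw [show p - s + s = p by omega] at e1
            rw [show p - s + 1 + s = p + 1 by omega] at e2
            rw [← e1, ← e2]
            exact morseThue_ne_succ_of_even (by omega)
        have two : ∀ p, a + s ≤ p → p + 2 < a + 3 * s → morseThue p = morseThue (p + 2) := by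
          intro p hp1 hp2
          have e1 := alt p hp1 (by omega)
          have e2 := alt (p + 1) (by omega) (by omega)
          revert e1 e2
          rw [show p + 1 + 1 = p + 2 by omega]
          cases morseThue p <;> cases morseThue (p + 1) <;> cases morseThue (p + 2) <;> simp
        -- Letters two apart agree, hence three consecutive even positions carry the same letter;
        -- halving them gives three equal letters in a row. There is room for this because `s ≥ 3`.
        have e1 := two (2 * ((a + s + 1) / 2)) (by omega) (by omega)
        have e2 := two (2 * ((a + s + 1) / 2 + 1)) (by omega) (by omega)
        rw [show 2 * ((a + s + 1) / 2) + 2 = 2 * ((a + s + 1) / 2 + 1) by ring,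
          morseThue_two_mul, morseThue_two_mul] at e1
        rw [show 2 * ((a + s + 1) / 2 + 1) + 2 = 2 * ((a + s + 1) / 2 + 2) by ring,
          morseThue_two_mul, morseThue_two_mul] at e2
        exact morseThue_no_three _ e1 e2

/-! ### The tree of words -/

section WordTree

variable {Ω : Type*}

theorem wordTree_adj_append (w : List Ω) (a : Ω) : (wordTree Ω).Adj w (w ++ [a]) :=
  Or.inl ⟨a, rfl⟩

theorem exists_walk_append (w e : List Ω) :
    ∃ p : (wordTree Ω).Walk w (w ++ e), p.length = e.length := by
  induction e generalizing w with
  | nil => exact ⟨SimpleGraph.Walk.nil.copy rfl (by simp), by simp⟩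
  | cons a e ih =>
    obtain ⟨p, hp⟩ := ih (w ++ [a])
    exact ⟨((SimpleGraph.Walk.cons (wordTree_adj_append w a) p)).copy rfl (by simp), by simp [hp]⟩

theorem wordTree_dist_append_le (w e : List Ω) :
    (wordTree Ω).dist w (w ++ e) ≤ e.length := by
  obtain ⟨p, hp⟩ := exists_walk_append w e
  exact hp ▸ SimpleGraph.dist_le p

theorem wordTree_connected : (wordTree Ω).Connected := by
  have : ∀ w : List Ω, (wordTree Ω).Reachable [] w := fun w => by
    obtain ⟨p, -⟩ := exists_walk_append [] w
    exact ⟨p⟩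
  exact ⟨fun u v => (this u).symm.trans (this v)⟩

/-- The prefix is what the walk never erases. Going back by one edge changes it only if the edge
writes the last letter of the prefix, and then one letter is given up. -/
theorem exists_common_prefix_of_walk {D D' : List Ω} (p : (wordTree Ω).Walk D D') :
    ∃ P, P <+: D ∧ P <+: D' ∧ D.length + D'.length ≤ p.length + 2 * P.length := by
  induction p with
  | nil => exact ⟨_, List.prefix_rfl, List.prefix_rfl, by simp; omega⟩
  | @cons w u w' hadj p ih =>
    obtain ⟨P, h1, h2, h3⟩ := ih
    rw [SimpleGraph.Walk.length_cons]
    rcases hadj with ⟨a, rfl⟩ | ⟨a, rfl⟩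
    · rw [List.prefix_concat_iff] at h1
      rcases h1 with rfl | h1
      · refine ⟨w, List.prefix_rfl, (List.prefix_append _ _).trans h2, ?_⟩
        simp at h3 ⊢
        omega
      · refine ⟨P, h1, h2, ?_⟩
        simp at h3 ⊢
        omega
    · refine ⟨P, h1.trans (List.prefix_append _ _), h2, ?_⟩
      simp at h3 ⊢
      omega

/-- The path metric of the tree of words is bounded below by the lengths of the branches after a
common prefix. -/
theorem exists_common_prefix (D D' : List Ω) :
    ∃ P, P <+: D ∧ P <+: D' ∧
      D.length + D'.length ≤ (wordTree Ω).dist D D' + 2 * P.length := by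
  obtain ⟨p, hp⟩ := wordTree_connected.exists_walk_length_eq_dist D D'
  exact hp ▸ exists_common_prefix_of_walk p

/-- Every edge is a bridge: once the edge between `w` and `w ++ [a]` is deleted, no walk enters the
set of words beginning with `w ++ [a]` from outside. -/
theorem wordTree_isTree : (wordTree Ω).IsTree := by
  refine ⟨wordTree_connected, ?_⟩
  rw [SimpleGraph.isAcyclic_iff_forall_adj_isBridge]
  have key : ∀ (w : List Ω) (a : Ω), (wordTree Ω).IsBridge s(w, w ++ [a]) := by
    intro w a
    rw [SimpleGraph.isBridge_iff]
    rintro ⟨p⟩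
    have inv : ∀ {x y : List Ω} (p : ((wordTree Ω).deleteEdges {s(w, w ++ [a])}).Walk x y),
        (w ++ [a]) <+: y → (w ++ [a]) <+: x := by
      intro x y p
      induction p with
      | nil => exact id
      | @cons x u y hadj p ih =>
        intro hy
        have hu := ih hy
        rw [SimpleGraph.deleteEdges_adj] at hadj
        obtain ⟨hadj, hne⟩ := hadj
        rcases hadj with ⟨b, rfl⟩ | ⟨b, rfl⟩
        · rcases List.prefix_concat_iff.1 hu with h | h
          · obtain ⟨rfl, hb⟩ := List.append_inj' h rfl
            simp at hb
            subst hb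
            simp at hne
          · exact h
        · exact hu.trans (List.prefix_append _ _)
    have := (inv p List.prefix_rfl).length_le
    simp at this
  intro v w h
  rcases h with ⟨a, rfl⟩ | ⟨a, rfl⟩
  · exact key v a
  · rw [Sym2.eq_swap]
    exact key w a

theorem wordTree_neighborSet_finite [Finite Ω] (w : List Ω) :
    ((wordTree Ω).neighborSet w).Finite := by
  refine ((Set.finite_singleton w.dropLast).union (Set.finite_range fun a => w ++ [a])).subset ?_
  rintro u (⟨a, rfl⟩ | ⟨a, rfl⟩)
  · exact Or.inr ⟨a, rfl⟩
  · left
    simp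

end WordTree

/-! ### Reading the diary -/

section Diary

variable {L : Type*}

/-- All symbols of a sentence, the most recent one first, written on top of `rest`. -/
def text : List L → List (List L × L) → List L
  | rest, [] => rest
  | rest, (w, s) :: α => text (s :: (w.reverse ++ rest)) α

/-- The number of symbols of a sentence, stop signs included. -/
def weight (α : List (List L × L)) : ℕ := (α.map fun p => p.1.length + 1).sum

/-- The letters of a sentence without the stop signs. -/
def flat (α : List (List L × L)) : List L := α.flatMap Prod.fst

theorem text_append_rest (rest : List L) (α : List (List L × L)) :
    text rest α = text [] α ++ rest := by
  induction α generalizing rest with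
  | nil => rfl
  | cons p α ih =>
    obtain ⟨w, s⟩ := p
    rw [text, ih, text, ih (s :: (w.reverse ++ []))]
    simp

theorem text_append (rest : List L) (α β : List (List L × L)) :
    text rest (α ++ β) = text (text rest α) β := by
  induction α generalizing rest with
  | nil => rfl
  | cons p α ih => simp [text, ih]

theorem length_text (α : List (List L × L)) : (text [] α).length = weight α := by
  induction α with
  | nil => rfl
  | cons p α ih =>
    obtain ⟨w, s⟩ := p
    rw [text, text_append_rest, List.length_append, ih]
    simp [weight]
    omega

theorem length_diaryFrom (κ : ℕ) (rest : List L) (α : List (List L × L)) :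
    (diaryFrom κ rest α).length = α.length := by
  induction α generalizing rest with
  | nil => rfl
  | cons p α ih => simp [diaryFrom, ih]

theorem length_diary (κ : ℕ) (α : List (List L × L)) : (diary κ α).length = α.length :=
  length_diaryFrom κ [] α

theorem diaryFrom_prefix (κ : ℕ) (rest : List L) (α β : List (List L × L)) :
    diaryFrom κ rest α <+: diaryFrom κ rest (α ++ β) := by
  induction α generalizing rest with
  | nil => simp [diaryFrom]
  | cons p α ih => simpa [diaryFrom] using ih _

theorem diary_prefix {κ : ℕ} {α β : List (List L × L)} (h : α <+: β) :
    diary κ α <+: diary κ β := by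
  obtain ⟨γ, rfl⟩ := h
  exact diaryFrom_prefix κ [] α γ

/-- A short page lists everything that is left, so in both cases the page shows exactly the first
`κ` entries. -/
theorem take_eq_of_writePage_eq {κ : ℕ} {l l' : List L} (h : writePage κ l = writePage κ l') :
    l.take κ = l'.take κ := by
  unfold writePage at h
  split_ifs at h with h1 h2 h2
  · exact congrArg Subtype.val (Sum.inl.inj h)
  · have : ∀ (n m : Fin κ) (a : List.Vector L n) (b : List.Vector L m),
        (⟨n, a⟩ : Σ n : Fin κ, List.Vector L n) = ⟨m, b⟩ → a.1 = b.1 := by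
      rintro n m a b h
      cases h
      rfl
    have := this _ _ _ _ (Sum.inr.inj h)
    simp only at this
    rw [this]

/-- `P` holds for the stop signs of the sentence, and only for these. -/
def StopsMarked (P : L → Prop) (α : List (List L × L)) : Prop :=
  ∀ p ∈ α, (∀ x ∈ p.1, ¬ P x) ∧ P p.2

variable (P : L → Prop) [DecidablePred P]

theorem countP_text {α : List (List L × L)} (h : StopsMarked P α) :
    (text [] α).countP (P ·) = α.length := by
  induction α with
  | nil => rfl
  | cons p α ih =>
    obtain ⟨w, s⟩ := p
    have h1 := h (w, s) (by simp)
    have h2 : w.countP (P ·) = 0 := by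
      rw [List.countP_eq_zero]
      simpa using h1.1
    rw [text, text_append_rest, List.countP_append, ih fun p hp => h p (by simp [hp])]
    simp [h1.2, h2]

theorem filter_text {α : List (List L × L)} (h : StopsMarked P α) :
    (text [] α).filter (fun x => ¬ P x) = (flat α).reverse := by
  induction α with
  | nil => rfl
  | cons p α ih =>
    obtain ⟨w, s⟩ := p
    have h1 := h (w, s) (by simp)
    have h2 : w.reverse.filter (fun x => ¬ P x) = w.reverse := by
      rw [List.filter_eq_self]
      simpa using h1.1
    rw [text, text_append_rest, List.filter_append, ih fun p hp => h p (by simp [hp])]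
    simp [flat, h1.2]
    simpa using h2

theorem text_ne_nil {α : List (List L × L)} (h : α ≠ []) (rest : List L) :
    ∃ p ∈ α, ∃ A, text rest α = p.2 :: A := by
  induction α generalizing rest with
  | nil => exact absurd rfl h
  | cons p α ih =>
    by_cases hα : α = []
    · subst hα
      exact ⟨p, by simp, _, rfl⟩
    · obtain ⟨q, hq, A, hA⟩ := ih hα (p.2 :: (p.1.reverse ++ rest))
      exact ⟨q, by simp [hq], A, hA⟩

/-- A list is determined by a prefix of it continued by a stop sign, if the number of the preceding
stop signs is known. -/
theorem eq_of_append_stop_prefix {A A' Y Y' : List L} {s s' : L} (hs : P s) (hs' : P s')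
    (hc : A.countP (P ·) = A'.countP (P ·)) (h : A ++ s :: Y <+: A' ++ s' :: Y') :
    A = A' ∧ s = s' ∧ Y <+: Y' := by
  induction A generalizing A' with
  | nil =>
    cases A' with
    | nil => simpa using h
    | cons a A' =>
      simp at h
      obtain ⟨rfl, -⟩ := h
      simp [hs] at hc
  | cons a A ih =>
    cases A' with
    | nil =>
      simp at h
      obtain ⟨rfl, -⟩ := h
      simp [hs'] at hc
    | cons b A' =>
      simp at h
      obtain ⟨rfl, h⟩ := h
      have := @ih A' (by simpa [List.countP_cons] using hc) (by simpa using h)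
      simpa using this

theorem take_prefix_of_take_eq {l l' : List L} {m : ℕ} (h : l.take m = l'.take m) :
    l.take m <+: l' := h ▸ List.take_prefix m l'

/-- Inserting the same block (or its known initial part) after a stop sign. -/
theorem take_insert {A A' Y Y' : List L} {s s' : L} {X X' : List L} {κ m : ℕ}
    (hs : P s) (hs' : P s') (hc : A.countP (P ·) = A'.countP (P ·))
    (hX : X.take κ = X'.take κ) (hY : Y = X.drop κ) (hY' : Y' = X'.drop κ)
    (h : (A ++ s :: Y).take m = (A' ++ s' :: Y').take m) :
    (A ++ s :: X).take m = (A' ++ s' :: X').take m ∧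
      (A.length + 1 ≤ m → (A ++ s :: X).take (m + κ) = (A' ++ s' :: X').take (m + κ)) := by
  -- If the known part reaches beyond the stop sign, counting the stop signs places it at the same
  -- position in both texts. The `κ` symbols listed on the page then fit in behind it, followed by
  -- what was known of `Y`.
  have big : A.length + 1 ≤ m → A = A' ∧ s = s' ∧ ∀ k, k ≤ m + κ →
      (A ++ s :: X).take k = (A' ++ s' :: X').take k := by
    intro hm
    have e : (A ++ s :: Y).take m = A ++ s :: Y.take (m - A.length - 1) := by
      rw [List.take_append, List.take_of_length_le (by omega)]
      rw [show m - A.length = (m - A.length - 1) + 1 by omega, List.take_succ_cons]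
      simp
    have h1 := take_prefix_of_take_eq h
    rw [e] at h1
    obtain ⟨rfl, rfl, -⟩ := eq_of_append_stop_prefix P hs hs' hc h1
    refine ⟨rfl, rfl, fun k hk => ?_⟩
    have e' : (A ++ s :: Y').take m = A ++ s :: Y'.take (m - A.length - 1) := by
      rw [List.take_append, List.take_of_length_le (by omega)]
      rw [show m - A.length = (m - A.length - 1) + 1 by omega, List.take_succ_cons]
      simp
    rw [e, e'] at h
    have h2 : Y.take (m - A.length - 1) = Y'.take (m - A.length - 1) := by simpa using h
    have h3 : X.take (κ + (m - A.length - 1)) = X'.take (κ + (m - A.length - 1)) := by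
      rw [List.take_add, List.take_add, hX, ← hY, ← hY', h2]
    have h4 : ∀ j, j ≤ κ + (m - A.length - 1) → X.take j = X'.take j := by
      intro j hj
      have := congrArg (List.take j) h3
      rwa [List.take_take, List.take_take, min_eq_left hj] at this
    rw [List.take_append, List.take_append]
    congr 1
    rcases Nat.eq_zero_or_pos (k - A.length) with h0 | h0
    · simp [h0]
    · rw [show k - A.length = (k - A.length - 1) + 1 by omega, List.take_succ_cons,
        List.take_succ_cons, h4 _ (by omega)]
  -- If the known part ends before the stop sign, it does not see what is inserted behind it.
  have small : ∀ {A : List L} {s : L} {Y X : List L}, m ≤ A.length →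
      (A ++ s :: Y).take m = (A ++ s :: X).take m := by
    intro A s Y X hm
    rw [List.take_append_of_le_length hm, List.take_append_of_le_length hm]
  refine ⟨?_, fun hm => (big hm).2.2 _ le_rfl⟩
  by_cases hm : A.length + 1 ≤ m
  · exact (big hm).2.2 _ (by omega)
  by_cases hm' : A'.length + 1 ≤ m
  · have e' : (A' ++ s' :: Y').take m = A' ++ s' :: Y'.take (m - A'.length - 1) := by
      rw [List.take_append, List.take_of_length_le (by omega)]
      rw [show m - A'.length = (m - A'.length - 1) + 1 by omega, List.take_succ_cons]
      simp
    have h1 := take_prefix_of_take_eq h.symm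
    rw [e'] at h1
    obtain ⟨rfl, -⟩ := eq_of_append_stop_prefix P hs' hs hc.symm h1
    omega
  · rw [← small (by omega), h, small (by omega)]

/-- Sentences with the same diary share the recent part of their texts: if every proper final part
of `γ` has at most as many symbols as its pages can list, then `κ * γ.length` symbols are known. -/
theorem take_text_eq {κ : ℕ} (β γ : List (List L × L)) :
    ∀ (β' γ' : List (List L × L)) (rest rest' : List L),
    β.length = β'.length → γ.length = γ'.length →
    StopsMarked P (β ++ γ) → StopsMarked P (β' ++ γ') →
    diaryFrom κ rest (β ++ γ) = diaryFrom κ rest' (β' ++ γ') →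
    (∀ d, 1 ≤ d → weight (γ.drop d) ≤ κ * (γ.drop d).length) →
    (text rest (β ++ γ)).tail.take (κ * γ.length) =
      (text rest' (β' ++ γ')).tail.take (κ * γ.length) := by
  -- prepending a word keeps what is known
  have step : ∀ (p p' : List L × L) (σ σ' : List (List L × L)) (rest rest' : List L) (m : ℕ),
      σ.length = σ'.length → StopsMarked P (p :: σ) → StopsMarked P (p' :: σ') →
      (p.1.reverse ++ rest).take κ = (p'.1.reverse ++ rest').take κ → σ ≠ [] →
      (text (p.2 :: (p.1.reverse ++ rest).drop κ) σ).tail.take m =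
        (text (p'.2 :: (p'.1.reverse ++ rest').drop κ) σ').tail.take m →
      (text rest (p :: σ)).tail.take m = (text rest' (p' :: σ')).tail.take m ∧
      (weight σ ≤ m →
        (text rest (p :: σ)).tail.take (m + κ) = (text rest' (p' :: σ')).tail.take (m + κ)) := by
    intro p p' σ σ' rest rest' m hl hp hp' hX hσ h
    have hσ' : σ' ≠ [] := by
      rintro rfl
      exact hσ (List.length_eq_zero_iff.1 hl)
    have hms : StopsMarked P σ := fun q hq => hp q (by simp [hq])
    have hms' : StopsMarked P σ' := fun q hq => hp' q (by simp [hq])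
    obtain ⟨q, hq, A, hA⟩ := text_ne_nil hσ []
    obtain ⟨q', hq', A', hA'⟩ := text_ne_nil hσ' []
    have hc := countP_text P hms
    have hc' := countP_text P hms'
    rw [hA] at hc
    rw [hA'] at hc'
    have hc2 : A.countP (P ·) = A'.countP (P ·) := by
      simp [(hms q hq).2] at hc
      simp [(hms' q' hq').2] at hc'
      omega
    have hlen := length_text σ
    rw [hA] at hlen
    rw [text_append_rest _ σ, text_append_rest _ σ', hA, hA'] at h
    have := take_insert P (hp p (by simp)).2 (hp' p' (by simp)).2 hc2 hX rfl rfl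
      (by simpa using h)
    rw [show text rest (p :: σ) = text (p.2 :: (p.1.reverse ++ rest)) σ from rfl,
      show text rest' (p' :: σ') = text (p'.2 :: (p'.1.reverse ++ rest')) σ' from rfl,
      text_append_rest _ σ, text_append_rest _ σ', hA, hA']
    -- `tail` drops the last stop sign, but the stop sign of `p` is added at the other end; so
    -- `weight σ` symbols are needed to reach beyond the latter.
    simp only [List.length_cons] at hlen
    rw [hlen] at this
    simpa using this
  have pages : ∀ (p p' : List L × L) (σ σ' : List (List L × L)) (rest rest' : List L),
      diaryFrom κ rest (p :: σ) = diaryFrom κ rest' (p' :: σ') →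
      (p.1.reverse ++ rest).take κ = (p'.1.reverse ++ rest').take κ ∧
      diaryFrom κ (p.2 :: (p.1.reverse ++ rest).drop κ) σ =
        diaryFrom κ (p'.2 :: (p'.1.reverse ++ rest').drop κ) σ' := by
    rintro ⟨w, s⟩ ⟨w', s'⟩ σ σ' rest rest' h
    simp only [diaryFrom, List.cons.injEq] at h
    exact ⟨take_eq_of_writePage_eq h.1, h.2⟩
  -- Each word of `γ` contributes `κ` new symbols, because by the weight bound the known part
  -- already covers all later words. No bound is available for the words of `β`; they only preserve
  -- what is known.
  induction β with
  | nil =>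
    intro β' γ' rest rest' hβ
    obtain rfl : β' = [] := List.length_eq_zero_iff.1 hβ.symm
    simp only [List.nil_append]
    clear hβ
    induction γ generalizing γ' rest rest' with
    | nil => simp
    | cons p σ ih =>
      intro hl hm hm' hd hb
      obtain ⟨p', σ', rfl⟩ : ∃ p' σ', γ' = p' :: σ' := by
        cases γ' with
        | nil => simp at hl
        | cons p' σ' => exact ⟨p', σ', rfl⟩
      obtain ⟨h1, h2⟩ := pages _ _ _ _ _ _ hd
      by_cases hσ : σ = []
      · subst hσ
        obtain rfl : σ' = [] := by
          simpa [eq_comm] using hl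
        simpa [text] using h1
      · have hl' : σ.length = σ'.length := by simpa using hl
        have := ih σ' _ _ hl' (fun q hq => hm q (by simp [hq])) (fun q hq => hm' q (by simp [hq]))
          h2 (fun d hd => by simpa using hb (d + 1) (by omega))
        have := (step p p' σ σ' rest rest' _ hl' hm hm' h1 hσ this).2
          (by simpa using hb 1 le_rfl)
        simpa [mul_add] using this
  | cons p β ih =>
    intro β' γ' rest rest' hβ hl hm hm' hd hb
    obtain ⟨p', β', rfl⟩ : ∃ p' σ', β' = p' :: σ' := by
      cases β' with
      | nil => simp at hβ
      | cons p' σ' => exact ⟨p', σ', rfl⟩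
    obtain ⟨h1, h2⟩ := pages _ _ _ _ _ _ hd
    have hβ' : β.length = β'.length := by simpa using hβ
    have := ih β' γ' _ _ hβ' hl (fun q hq => hm q (by simp at hq ⊢; tauto))
      (fun q hq => hm' q (by simp at hq ⊢; tauto)) h2 hb
    by_cases hσ : β ++ γ = []
    · obtain ⟨-, rfl⟩ := List.append_eq_nil_iff.1 hσ
      simp
    · exact (step p p' (β ++ γ) (β' ++ γ') rest rest' _ (by simp [hβ', hl]) hm hm' h1 hσ this).1

/-- Two sentences with a common initial part `ρ` and the same diary either have the same letters, or
many of their last letters coincide. -/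
theorem flat_eq_or_take_flat_eq {κ : ℕ} {ρ σ σ' : List (List L × L)}
    (hl : σ.length = σ'.length) (hm : StopsMarked P (ρ ++ σ)) (hm' : StopsMarked P (ρ ++ σ'))
    (hd : diary κ (ρ ++ σ) = diary κ (ρ ++ σ'))
    (hb : ∀ d, 2 ≤ d → weight (σ.drop d) ≤ κ * (σ.drop d).length) :
    flat (ρ ++ σ) = flat (ρ ++ σ') ∨
      ∃ R, (κ - 1) * (σ.length - 1) ≤ R ∧ R ≤ (flat (ρ ++ σ)).length ∧
        R ≤ (flat (ρ ++ σ')).length ∧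
        (flat (ρ ++ σ)).reverse.take R = (flat (ρ ++ σ')).reverse.take R := by
  rcases σ with _ | ⟨p, γ⟩
  · obtain rfl : σ' = [] := List.length_eq_zero_iff.1 hl.symm
    exact Or.inl rfl
  rcases σ' with _ | ⟨p', γ'⟩
  · simp at hl
  have hl2 : γ.length = γ'.length := by simpa using hl
  -- The first word of `σ` is counted with the initial part, since the weight bound is available
  -- only from the second drop on.
  have key := take_text_eq P (κ := κ) (ρ ++ [p]) γ (ρ ++ [p']) γ' [] [] (by simp) hl2
    (by simpa using hm) (by simpa using hm') (by simpa [diary] using hd)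
    (fun d hd => by simpa using hb (d + 1) (by omega))
  have hms : StopsMarked P (p :: γ) := fun q hq => hm q (by simp at hq ⊢; tauto)
  have hms' : StopsMarked P (p' :: γ') := fun q hq => hm' q (by simp at hq ⊢; tauto)
  obtain ⟨q, hq, H, hH⟩ := text_ne_nil (α := p :: γ) (by simp) []
  obtain ⟨q', hq', H', hH'⟩ := text_ne_nil (α := p' :: γ') (by simp) []
  have hc := countP_text P hms
  have hc' := countP_text P hms'
  rw [hH] at hc
  rw [hH'] at hc'
  have hcH : H.countP (P ·) = γ.length := by
    simpa [(hms q hq).2] using hc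
  have hcH' : H'.countP (P ·) = γ.length := by
    simpa [(hms' q' hq').2, hl2] using hc'
  have hf := filter_text P hms
  have hf' := filter_text P hms'
  rw [hH] at hf
  rw [hH'] at hf'
  have hfH : H.filter (fun x => ¬ P x) = (flat (p :: γ)).reverse := by
    simpa [(hms q hq).2] using hf
  have hfH' : H'.filter (fun x => ¬ P x) = (flat (p' :: γ')).reverse := by
    simpa [(hms' q' hq').2] using hf'
  have flat_app : ∀ τ : List (List L × L), flat (ρ ++ τ) = flat ρ ++ flat τ := by
    intro τ
    simp [flat]
  simp only [List.append_assoc, List.singleton_append] at key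
  rw [text_append, text_append, text_append_rest _ (p :: γ), text_append_rest _ (p' :: γ'), hH,
    hH'] at key
  simp only [List.cons_append, List.tail_cons] at key
  set Q := text [] ρ with hQ
  set m := κ * γ.length with hmdef
  -- `H` is delimited by the last stop sign of `ρ`, or by the beginning of the text if `ρ` is empty.
  -- If the known part is longer than `H`, counting stop signs recovers all of `H`.
  have full : ∀ {H H' : List L}, H.countP (P ·) = H'.countP (P ·) → H.length + 1 ≤ m →
      (H ++ Q).take m = (H' ++ Q).take m → H = H' := by
    intro H H' hc hlen h
    by_cases hρ : ρ = []
    · have hQ0 : Q = [] := by rw [hQ, hρ]; rfl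
      rw [hQ0, List.append_nil, List.append_nil, List.take_of_length_le (by omega)] at h
      have : H'.length < m := by
        by_contra! hcon
        have := congrArg List.length h
        simp at this
        omega
      rw [h, List.take_of_length_le this.le]
    · obtain ⟨x, hx, B, hB⟩ := text_ne_nil hρ []
      rw [← hQ] at hB
      have hPx : P x.2 := (hm x (by simp [hx])).2
      have h1 := take_prefix_of_take_eq h
      rw [hB, List.take_append, List.take_of_length_le (by omega),
        show m - H.length = (m - H.length - 1) + 1 by omega, List.take_succ_cons] at h1
      exact (eq_of_append_stop_prefix P hPx hPx hc h1).1
  by_cases h1 : H.length + 1 ≤ m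
  · left
    have := full (hcH.trans hcH'.symm) h1 key
    subst this
    rw [flat_app, flat_app]
    congr 1
    have := hfH.symm.trans hfH'
    simpa using this
  by_cases h2 : H'.length + 1 ≤ m
  · left
    have := full (hcH'.trans hcH.symm) h2 key.symm
    subst this
    rw [flat_app, flat_app]
    congr 1
    have := hfH.symm.trans hfH'
    simpa using this
  -- The known symbols now lie entirely in `H`. At most `γ.length` of them are stop signs, which
  -- leaves at least `(κ - 1) * γ.length` letters.
  right
  rw [List.take_append_of_le_length (by omega), List.take_append_of_le_length (by omega)] at key
  set K := H.take m with hK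
  have hKlen : K.length = m := by simp [hK]; omega
  have hKc : K.countP (P ·) ≤ γ.length := hcH ▸ (List.take_sublist m H).countP_le
  have hsplit : K.length = K.countP (P ·) + (K.filter (fun x => ¬ P x)).length := by
    rw [List.length_eq_countP_add_countP (P ·), ← List.countP_eq_length_filter]
    simp
  have hpre : ∀ {H : List L}, K <+: H → ∀ {f : List L}, H.filter (fun x => ¬ P x) = f.reverse →
      K.filter (fun x => ¬ P x) <+: (flat ρ ++ f).reverse := by
    intro H hKH f hf
    rw [List.reverse_append, ← hf]
    exact (hKH.filter _).trans (List.prefix_append _ _)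
  have p1 := hpre (List.take_prefix m H) hfH
  have p2 := hpre (key ▸ List.take_prefix m H') hfH'
  refine ⟨(K.filter (fun x => ¬ P x)).length, ?_, ?_, ?_, ?_⟩
  · simp only [List.length_cons, Nat.add_sub_cancel]
    rw [Nat.sub_mul, one_mul, ← hmdef]
    omega
  · rw [flat_app]
    simpa [add_comm] using p1.length_le
  · rw [flat_app]
    simpa [add_comm] using p2.length_le
  · rw [flat_app, flat_app, ← List.prefix_iff_eq_take.1 p1, ← List.prefix_iff_eq_take.1 p2]

end Diary

section Existence

variable {Z : Type*} [MetricSpace Z]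

/-! ### Existence of hyperbolic approximations -/

theorem exists_maximal_isSep (a : ℝ) : ∃ S : Set Z, Maximal (IsSep a) S := by
  obtain ⟨S, -, hS⟩ := zorn_subset_nonempty {S : Set Z | IsSep a S} (fun c hc hchain _ => by
    refine ⟨⋃₀ c, ?_, fun s hs => subset_sUnion_of_mem hs⟩
    rintro x ⟨s, hs, hx⟩ y ⟨t, ht, hy⟩ hne
    rcases hchain.total hs ht with h | h
    · exact hc ht (h hx) hy hne
    · exact hc hs hx (h hy) hne) ∅ (by simp [IsSep])
  exact ⟨S, hS⟩

theorem exists_isGreatest_zpow {r D : ℝ} (hr : 0 < r) (hr1 : r < 1) (hD : 0 < D) :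
    ∃ k : ℤ, IsGreatest {k : ℤ | D < r ^ k} k := by
  obtain ⟨m, hm⟩ := exists_pow_lt_of_lt_one hD hr1
  obtain ⟨m', hm'⟩ := exists_pow_lt_of_lt_one (inv_pos.2 hD) hr1
  have hlow : D < r ^ (-(m' : ℤ)) := by
    rw [zpow_neg, zpow_natCast]
    exact lt_inv_of_lt_inv₀ (pow_pos hr _) hm'
  obtain ⟨k, hk, hmax⟩ := Int.exists_greatest_of_bdd (P := fun k : ℤ => D < r ^ k)
    ⟨m, fun k hk => by
      by_contra! hcon
      have := zpow_le_zpow_right_of_le_one₀ hr hr1.le hcon.le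
      rw [zpow_natCast] at this
      linarith⟩ ⟨_, hlow⟩
  exact ⟨k, hk, fun j hj => hmax j hj⟩

theorem nonempty_hypApprox {r : ℝ} (hr : 0 < r) (hr6 : r ≤ 1 / 6)
    (hD : 0 < Metric.diam (univ : Set Z)) : Nonempty (HypApprox Z r) := by
  obtain ⟨k, hk⟩ := exists_isGreatest_zpow hr (by linarith) hD
  choose net hnet using fun k : ℤ => exists_maximal_isSep (Z := Z) (r ^ k)
  exact ⟨⟨hr, hr6, k, hk, net, fun k _ => hnet k⟩⟩

/-! ### Proper colorings of the nets -/

theorem IsDoubling.exists_cover {N : ℕ}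
    (hN : ∀ (x : Z) (ρ : ℝ), 0 < ρ →
      ∃ s : Finset Z, s.card ≤ N ∧ Metric.ball x ρ ⊆ ⋃ y ∈ s, Metric.ball y (ρ / 2))
    (m : ℕ) (x : Z) (ρ : ℝ) (hρ : 0 < ρ) :
    ∃ s : Finset Z, s.card ≤ N ^ m ∧ Metric.ball x ρ ⊆ ⋃ y ∈ s, Metric.ball y (ρ / 2 ^ m) := by
  classical
  induction m with
  | zero => exact ⟨{x}, by simp⟩
  | succ m ih =>
    obtain ⟨s, hs, hcov⟩ := ih
    choose t ht hct using fun y : Z => hN y (ρ / 2 ^ m) (by positivity)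
    refine ⟨s.biUnion t, ?_, ?_⟩
    · calc (s.biUnion t).card ≤ s.card * N := Finset.card_biUnion_le_card_mul _ _ _ fun y _ => ht y
        _ ≤ N ^ m * N := Nat.mul_le_mul_right _ hs
        _ = N ^ (m + 1) := (pow_succ _ _).symm
    · intro z hz
      obtain ⟨y, hy, hzy⟩ := mem_iUnion₂.1 (hcov hz)
      obtain ⟨w, hw, hzw⟩ := mem_iUnion₂.1 (hct y hzy)
      refine mem_iUnion₂.2 ⟨w, Finset.mem_biUnion.2 ⟨y, hy, hw⟩, ?_⟩
      rwa [div_div, ← pow_succ] at hzw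

/-- Separated subsets of a ball of a doubling space have bounded cardinality. -/
theorem IsDoubling.card_le {N : ℕ}
    (hN : ∀ (x : Z) (ρ : ℝ), 0 < ρ →
      ∃ s : Finset Z, s.card ≤ N ∧ Metric.ball x ρ ⊆ ⋃ y ∈ s, Metric.ball y (ρ / 2))
    (m : ℕ) (x : Z) (ρ a : ℝ) (hρ : 0 < ρ) (ha : 2 * ρ ≤ 2 ^ m * a) (t : Finset Z)
    (ht : (t : Set Z) ⊆ Metric.ball x ρ) (hsep : IsSep a (t : Set Z)) : t.card ≤ N ^ m := by
  obtain ⟨s, hs, hcov⟩ := IsDoubling.exists_cover hN m x ρ hρ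
  have : ∀ z ∈ t, ∃ y ∈ s, z ∈ Metric.ball y (ρ / 2 ^ m) := fun z hz => by
    simpa using hcov (ht hz)
  choose! g hg hzg using this
  refine (Finset.card_le_card_of_injOn g hg fun z hz w hw hzw => ?_).trans hs
  by_contra hne
  have h1 := hsep hz hw hne
  have h2 := hzg z hz
  have h3 := hzg w hw
  rw [← hzw] at h3
  have h4 := dist_triangle_right z w (g z)
  rw [Metric.mem_ball] at h2 h3
  have h5 : 2 * (ρ / 2 ^ m) ≤ a := by
    rw [← mul_div_assoc, div_le_iff₀ (by positivity)]
    linarith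
  linarith

/-- Greedy coloring. -/
theorem exists_greedy_coloring {M : ℕ} (ρ : ℝ) (s : Finset Z)
    (hs : ∀ x ∈ s, ∀ t : Finset Z, t ⊆ s → (∀ y ∈ t, dist x y < ρ) → t.card ≤ M) :
    ∃ μ : Z → Fin (M + 1), ∀ x ∈ s, ∀ y ∈ s, x ≠ y → dist x y < ρ → μ x ≠ μ y := by
  classical
  induction s using Finset.induction_on with
  | empty => exact ⟨fun _ => 0, by simp⟩
  | insert a s ha ih =>
    obtain ⟨μ, hμ⟩ := ih fun x hx t ht => hs x (by simp [hx]) t (ht.trans (Finset.subset_insert _ _))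
    set t := s.filter fun y => dist a y < ρ with ht
    have h1 : (t.image μ).card < Fintype.card (Fin (M + 1)) := by
      rw [Fintype.card_fin]
      refine Nat.lt_succ_of_le (Finset.card_image_le.trans (hs a (by simp) t ?_ ?_))
      · exact (Finset.filter_subset _ _).trans (Finset.subset_insert _ _)
      · intro y hy
        exact (Finset.mem_filter.1 hy).2
    obtain ⟨i, hi⟩ : ∃ i, i ∉ t.image μ := by
      by_contra! hcon
      rw [Finset.eq_univ_iff_forall.2 hcon, Finset.card_univ] at h1
      exact lt_irrefl _ h1
    have key : ∀ y ∈ s, dist a y < ρ → i ≠ μ y := by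
      rintro y hy hd rfl
      exact hi (Finset.mem_image_of_mem _ (Finset.mem_filter.2 ⟨hy, hd⟩))
    refine ⟨Function.update μ a i, fun x hx y hy hne hd => ?_⟩
    rw [Finset.mem_insert] at hx hy
    rcases hx with rfl | hx <;> rcases hy with rfl | hy
    · exact absurd rfl hne
    · rw [Function.update_self, Function.update_of_ne hne.symm]
      exact key y hy hd
    · rw [Function.update_self, Function.update_of_ne hne]
      exact (key x hx (by rwa [dist_comm])).symm
    · rw [Function.update_of_ne (by rintro rfl; exact ha hx),
        Function.update_of_ne (by rintro rfl; exact ha hy)]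
      exact hμ x hx y hy hne hd

/-- The ratio of `2 * r ^ (k - 2)` to the separation `r ^ k` does not depend on `k`. Hence the
packing bound for conflicting vertices, and with it the number of greedy colors, is the same for all
levels and all `X`. -/
theorem exists_isProperColoring (hbounded : Bornology.IsBounded (univ : Set Z))
    (hdoubling : IsDoubling Z) {r : ℝ} (hr : 0 < r) :
    ∃ N : ℕ, ∀ X : HypApprox Z r, ∃ μ : X.Vertex → Fin N, X.IsProperColoring μ := by
  obtain ⟨N, hN⟩ := hdoubling
  obtain ⟨m, hm⟩ := pow_unbounded_of_one_lt (4 / r ^ 2) (one_lt_two (α := ℝ))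
  refine ⟨N ^ m + 1, fun X => ?_⟩
  -- Greedy coloring needs a finite set: the nets are finite because `Z` is bounded and doubling.
  have hfin : ∀ k, X.k₀ ≤ k → (X.net k).Finite := by
    intro k hk
    rcases (X.net k).eq_empty_or_nonempty with h0 | ⟨x, -⟩
    · simp [h0]
    obtain ⟨R, hR0, hR⟩ := hbounded.subset_ball_lt 0 x
    have hrk : 0 < r ^ k := zpow_pos hr k
    obtain ⟨m, hm⟩ := pow_unbounded_of_one_lt (2 * R / r ^ k) (one_lt_two (α := ℝ))
    by_contra hinf
    obtain ⟨t, ht, hcard⟩ := Set.Infinite.exists_subset_card_eq hinf (N ^ m + 1)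
    have := IsDoubling.card_le hN m x R (r ^ k) hR0 ((div_lt_iff₀ hrk).1 hm).le t
      (fun z _ => hR (mem_univ z)) ((X.maximal_net k hk).prop.mono ht)
    omega
  have hcol : ∀ k, X.k₀ ≤ k → ∃ μ : Z → Fin (N ^ m + 1), ∀ x ∈ X.net k, ∀ y ∈ X.net k, x ≠ y →
      dist x y < 2 * r ^ (k - 2) → μ x ≠ μ y := by
    intro k hk
    obtain ⟨μ, hμ⟩ := exists_greedy_coloring (M := N ^ m) (2 * r ^ (k - 2)) (hfin k hk).toFinset
      (fun x _ t ht hd => IsDoubling.card_le hN m x (2 * r ^ (k - 2)) (r ^ k)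
        (by have := zpow_pos hr (k - 2); positivity) (by
          have h1 : r ^ k = r ^ (k - 2) * r ^ 2 := by
            rw [← zpow_natCast r 2, ← zpow_add₀ hr.ne']
            simp
          rw [h1]
          have h2 := (div_lt_iff₀ (by positivity)).1 hm
          nlinarith [zpow_pos hr (k - 2)]) t
        (fun y hy => by rw [Metric.mem_ball, dist_comm]; exact hd y hy)
        ((X.maximal_net k hk).prop.mono fun y hy => by simpa using ht hy))
    exact ⟨μ, fun x hx y hy => hμ x (by simpa using hx) y (by simpa using hy)⟩
  choose! μ hμ using hcol
  refine ⟨fun v => μ v.level v.point, fun v w hne hl hd => ?_⟩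
  have hp : v.point ≠ w.point := fun h => hne (Subtype.ext (Prod.ext hl h))
  change μ v.level v.point ≠ μ w.level w.point
  rw [← hl]
  exact hμ v.level v.2.1 _ v.2.2 _ (hl ▸ w.2.2) hp hd

/-! ### Adapted coverings -/

theorem capacityProperty_of_cdim_eq {n : ℕ} (hn : cdim Z = n) : CapacityProperty Z n := by
  have h1 : cdim Z < ((n + 1 : ℕ) : ℕ∞) := by
    rw [hn]
    exact_mod_cast Nat.lt_succ_self n
  unfold cdim at h1 hn
  simp only [iInf_lt_iff] at h1
  obtain ⟨m, hm, hlt⟩ := h1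
  have h2 : (n : ℕ∞) ≤ m := hn ▸ iInf₂_le m hm
  have h3 : m < n + 1 := by exact_mod_cast hlt
  have h4 : n ≤ m := by exact_mod_cast h2
  obtain rfl : m = n := by omega
  exact hm

/-- A covering at scale `t` whose members of one color are well separated and whose Lebesgue number
is comparable to `t`. -/
theorem CapacityProperty.exists_separated_cover {n : ℕ} (h : CapacityProperty Z n) {C : Type*}
    [Fintype C] (hC : Fintype.card C = n + 1) :
    ∃ δ : ℝ, 0 < δ ∧ ∃ τ₀ : ℝ, 0 < τ₀ ∧ ∀ τ : ℝ, 0 < τ → τ < τ₀ →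
      ∃ 𝒲 : C → Set (Set Z), (∀ c, ∀ W ∈ 𝒲 c, IsOpen W ∧ W.Nonempty ∧
          ∀ x ∈ W, ∀ y ∈ W, dist x y ≤ τ) ∧
        (∀ c, ∀ W ∈ 𝒲 c, ∀ W' ∈ 𝒲 c, W ≠ W' → ∀ x ∈ W, ∀ y ∈ W', δ * τ ≤ dist x y) ∧
        ∀ z, ∃ c, ∃ W ∈ 𝒲 c, Metric.ball z (δ * τ) ⊆ W := by
  obtain ⟨δ, hδ, τ₀, hτ₀, h⟩ := h
  refine ⟨δ / 4, by positivity, τ₀, hτ₀, fun τ hτ hτlt => ?_⟩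
  obtain ⟨𝒰, hcov, hmesh, hleb⟩ := h τ hτ hτlt
  let e : C ≃ Fin (n + 1) := Fintype.equivFinOfCardEq hC
  -- Removing a collar of width `δ * τ / 2` separates the members of one color. A point deeper than
  -- `3/4 * (δ * τ)` in a member keeps a ball of radius `δ * τ / 4` inside the shrunken member.
  let sh : Set Z → Set Z := fun U => {z | ENNReal.ofReal (δ * τ / 2) < Metric.infEDist z Uᶜ}
  have sub : ∀ U, sh U ⊆ U := by
    intro U z hz
    by_contra hzU
    have : Metric.infEDist z Uᶜ = 0 := Metric.infEDist_zero_of_mem hzU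
    simp only [sh, mem_ofPred_eq, this] at hz
    exact not_lt_bot hz
  refine ⟨fun c => {W | W.Nonempty ∧ ∃ U ∈ 𝒰 (e c), W = sh U}, ?_, ?_, ?_⟩
  · rintro c _ ⟨hne, U, hU, rfl⟩
    refine ⟨isOpen_lt continuous_const Metric.continuous_infEDist, hne, fun x hx y hy => ?_⟩
    have h1 : edist x y ≤ ENNReal.ofReal τ := by
      refine (Metric.edist_le_ediam_of_mem (sub U hx) (sub U hy)).trans (le_trans ?_ hmesh)
      exact le_iSup_of_le (e c) (le_iSup₂_of_le U hU le_rfl)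
    rw [edist_dist] at h1
    exact (ENNReal.ofReal_le_ofReal_iff hτ.le).1 h1
  · rintro c _ ⟨-, U, hU, rfl⟩ _ ⟨-, U', hU', rfl⟩ hne x hx y hy
    have hUU : U ≠ U' := by rintro rfl; exact hne rfl
    have hdisj := hcov.disjoint (e c) hU hU' hUU
    have hyU : y ∈ Uᶜ := fun hyU => disjoint_left.1 hdisj hyU (sub U' hy)
    have h1 : ENNReal.ofReal (δ * τ / 2) < edist x y := lt_of_lt_of_le hx
      (Metric.infEDist_le_edist_of_mem hyU)
    rw [edist_dist] at h1
    have := (ENNReal.ofReal_lt_ofReal_iff_of_nonneg (by positivity)).1 h1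
    nlinarith [mul_pos hδ hτ]
  · intro z
    have h1 : ENNReal.ofReal (3 / 4 * (δ * τ)) < ⨆ c, ⨆ U ∈ 𝒰 c, Metric.infEDist z Uᶜ := by
      refine lt_of_lt_of_le ?_ ((hleb.trans (iInf_le _ z)).trans (min_le_left _ _))
      exact (ENNReal.ofReal_lt_ofReal_iff (by positivity)).2 (by nlinarith [mul_pos hδ hτ])
    simp only [lt_iSup_iff] at h1
    obtain ⟨c, U, hU, hz⟩ := h1
    have hball : Metric.ball z (δ / 4 * τ) ⊆ sh U := by
      intro y hy
      rw [Metric.mem_ball'] at hy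
      have h2 : Metric.infEDist z Uᶜ ≤ Metric.infEDist y Uᶜ + edist z y :=
        Metric.infEDist_le_infEDist_add_edist
      by_contra hcon
      have h3 : Metric.infEDist y Uᶜ ≤ ENNReal.ofReal (δ * τ / 2) := not_lt.1 hcon
      have h4 : edist z y ≤ ENNReal.ofReal (δ / 4 * τ) := by
        rw [edist_dist]
        exact ENNReal.ofReal_le_ofReal hy.le
      have h5 := hz.trans_le (h2.trans (add_le_add h3 h4))
      rw [← ENNReal.ofReal_add (by positivity) (by positivity)] at h5
      have := (ENNReal.ofReal_lt_ofReal_iff_of_nonneg (by positivity)).1 h5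
      linarith
    refine ⟨e.symm c, sh U, ⟨⟨z, hball (Metric.mem_ball_self (by positivity))⟩, U, ?_, rfl⟩, hball⟩
    simpa using hU

/-! ### Saturation of separated families along chains of smaller members -/

section Saturation

variable (r : ℝ) (𝒲 : ℕ → Set (Set Z))

/-- `x` and `y` lie in the neighborhood of one member of a level in `(j, J]`. -/
def Linked (j J : ℕ) (x y : Z) : Prop :=
  ∃ i, j < i ∧ i ≤ J ∧ ∃ W ∈ 𝒲 i, x ∈ Metric.thickening (5 * r ^ (i + 1)) W ∧
    y ∈ Metric.thickening (5 * r ^ (i + 1)) W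

/-- The union of `W` with all chains of members of the levels above `j` which start in `W`. -/
def saturation (j : ℕ) (W : Set Z) : Set Z :=
  {y | ∃ x ∈ W, ∃ J, Relation.ReflTransGen (Linked r 𝒲 j J) x y}

variable {r 𝒲}

theorem reflTransGen_linked_mono {j j' J J' : ℕ} (hj : j' ≤ j) (hJ : J ≤ J') {x y : Z}
    (h : Relation.ReflTransGen (Linked r 𝒲 j J) x y) :
    Relation.ReflTransGen (Linked r 𝒲 j' J') x y :=
  Relation.ReflTransGen.mono (fun _ _ ⟨i, h1, h2, hW⟩ => ⟨i, by omega, by omega, hW⟩) _ _ h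

theorem isOpen_saturation {j : ℕ} {W : Set Z} (hW : IsOpen W) :
    IsOpen (saturation r 𝒲 j W) := by
  rw [isOpen_iff_mem_nhds]
  rintro y ⟨x, hx, J, hJ⟩
  rcases Relation.ReflTransGen.cases_tail hJ with rfl | ⟨z, hxz, i, h1, h2, V, hV, hz, hy⟩
  · exact Filter.mem_of_superset (hW.mem_nhds hx) fun a ha => ⟨a, ha, J, .refl⟩
  · exact Filter.mem_of_superset (Metric.isOpen_thickening.mem_nhds hy)
      fun a ha => ⟨x, hx, J, hxz.tail ⟨i, h1, h2, V, hV, hz, ha⟩⟩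

/-- Chains of members of the levels above `j` are short. -/
theorem dist_le_of_linked (hr : 0 < r) (hr24 : r ≤ 1 / 24)
    (hdiam : ∀ j, 1 ≤ j → ∀ W ∈ 𝒲 j, ∀ x ∈ W, ∀ y ∈ W, dist x y ≤ r ^ j / 2)
    (hsep : ∀ j, 1 ≤ j → ∀ W ∈ 𝒲 j, ∀ W' ∈ 𝒲 j, W ≠ W' → ∀ x ∈ W, ∀ y ∈ W',
      11 * r ^ (j + 1) ≤ dist x y)
    (d j J : ℕ) (hd : J = j + d) {x y : Z}
    (h : Relation.ReflTransGen (Linked r 𝒲 j J) x y) : dist x y ≤ r ^ (j + 1) := by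
  induction d generalizing j x y with
  | zero =>
    have : x = y := by
      induction h with
      | refl => rfl
      | tail _ h2 _ =>
        obtain ⟨i, h1, h2, -⟩ := h2
        omega
    rw [this, dist_self]
    positivity
  | succ d ih =>
    have ih' : ∀ {x y : Z}, Relation.ReflTransGen (Linked r 𝒲 (j + 1) J) x y →
        dist x y ≤ r ^ (j + 2) := fun h => ih (j + 1) (by omega) h
    have key : Relation.ReflTransGen (Linked r 𝒲 (j + 1) J) x y ∨
        ∃ W ∈ 𝒲 (j + 1), ∃ x' ∈ Metric.thickening (5 * r ^ (j + 2)) W,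
          ∃ y' ∈ Metric.thickening (5 * r ^ (j + 2)) W,
          Relation.ReflTransGen (Linked r 𝒲 (j + 1) J) x x' ∧
          Relation.ReflTransGen (Linked r 𝒲 (j + 1) J) y' y := by
      induction h with
      | refl => exact Or.inl .refl
      | @tail y z _ hyz ihs =>
        obtain ⟨i, h1, h2, W, hW, hy, hz⟩ := hyz
        by_cases hi : i = j + 1
        · subst hi
          right
          rcases ihs with hxy | ⟨W', hW', x', hx', y', hy', hxx', hyy'⟩
          · exact ⟨W, hW, y, hy, z, hz, hxy, .refl⟩
          · have hWW : W' = W := by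
              by_contra hne
              obtain ⟨a, ha, hya⟩ := Metric.mem_thickening_iff.1 hy'
              obtain ⟨b, hb, hyb⟩ := Metric.mem_thickening_iff.1 hy
              have h3 := hsep (j + 1) (by omega) W' hW' W hW hne a ha b hb
              have h4 := ih' hyy'
              have h5 := dist_triangle4 a y' y b
              rw [dist_comm a y'] at h5
              rw [show j + 1 + 1 = j + 2 by ring] at *
              linarith
            subst hWW
            exact ⟨W', hW, x', hx', z, hz, hxx', .refl⟩
        · have hl : Linked r 𝒲 (j + 1) J y z := ⟨i, by omega, h2, W, hW, hy, hz⟩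
          rcases ihs with hxy | ⟨W', hW', x', hx', y', hy', hxx', hyy'⟩
          · exact Or.inl (hxy.tail hl)
          · exact Or.inr ⟨W', hW', x', hx', y', hy', hxx', hyy'.tail hl⟩
    have e : r ^ (j + 2) = r * r ^ (j + 1) := by ring
    have hp : 0 < r ^ (j + 1) := by positivity
    rcases key with h | ⟨W, hW, x', hx', y', hy', hxx', hyy'⟩
    · have := ih' h
      nlinarith
    -- Two end pieces, two collars and one member add up to at most `12 * r ^ (j + 2) + r ^ (j + 1)
    -- / 2`; this is where `r ≤ 1 / 24` is needed.
    · obtain ⟨a, ha, hxa⟩ := Metric.mem_thickening_iff.1 hx'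
      obtain ⟨b, hb, hyb⟩ := Metric.mem_thickening_iff.1 hy'
      have h1 := ih' hxx'
      have h2 := ih' hyy'
      have h3 := hdiam (j + 1) (by omega) W hW a ha b hb
      have h4 := dist_triangle4 x x' y' y
      have h5 := dist_triangle4 x' a b y'
      rw [dist_comm b y'] at h5
      nlinarith

theorem exists_near_of_mem_saturation (hr : 0 < r) (hr24 : r ≤ 1 / 24)
    (hdiam : ∀ j, 1 ≤ j → ∀ W ∈ 𝒲 j, ∀ x ∈ W, ∀ y ∈ W, dist x y ≤ r ^ j / 2)
    (hsep : ∀ j, 1 ≤ j → ∀ W ∈ 𝒲 j, ∀ W' ∈ 𝒲 j, W ≠ W' → ∀ x ∈ W, ∀ y ∈ W',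
      11 * r ^ (j + 1) ≤ dist x y)
    {j : ℕ} {W : Set Z} {y : Z}
    (h : y ∈ saturation r 𝒲 j W) : ∃ x ∈ W, dist x y ≤ r ^ (j + 1) := by
  obtain ⟨x, hx, J, hJ⟩ := h
  exact ⟨x, hx, dist_le_of_linked hr hr24 hdiam hsep J j (j + J) rfl
    (reflTransGen_linked_mono le_rfl (by omega) hJ)⟩

/-- The neighborhood of a saturated member is either contained in, or disjoint from, any other
saturated member of the same or of a lower level. -/
theorem saturation_separated (hr : 0 < r) (hr24 : r ≤ 1 / 24)
    (hdiam : ∀ j, 1 ≤ j → ∀ W ∈ 𝒲 j, ∀ x ∈ W, ∀ y ∈ W, dist x y ≤ r ^ j / 2)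
    (hsep : ∀ j, 1 ≤ j → ∀ W ∈ 𝒲 j, ∀ W' ∈ 𝒲 j, W ≠ W' → ∀ x ∈ W, ∀ y ∈ W',
      11 * r ^ (j + 1) ≤ dist x y)
    {j j' : ℕ} (hj' : 1 ≤ j') (hjj : j' ≤ j) {W W' : Set Z}
    (hW : W ∈ 𝒲 j) (hW' : W' ∈ 𝒲 j') (hne : (j, W) ≠ (j', W')) {G : Set Z}
    (hG : ∀ p ∈ G, ∃ y ∈ saturation r 𝒲 j W, dist p y < 4 * r ^ (j + 1)) :
    G ⊆ saturation r 𝒲 j' W' ∨ G ∩ saturation r 𝒲 j' W' = ∅ := by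
  -- The width of the collars in `Linked` is `5 = 4 + 1`: the distance of `G` from the saturation
  -- plus that of the saturation from `W`.
  have hnear : ∀ p ∈ G, p ∈ Metric.thickening (5 * r ^ (j + 1)) W := by
    intro p hp
    obtain ⟨y, hy, hpy⟩ := hG p hp
    obtain ⟨x, hx, hxy⟩ := exists_near_of_mem_saturation hr hr24 hdiam hsep hy
    refine Metric.mem_thickening_iff.2 ⟨x, hx, ?_⟩
    have := dist_triangle p y x
    rw [dist_comm y x] at this
    linarith
  rcases hjj.lt_or_eq with hlt | rfl
  · by_cases h : (G ∩ saturation r 𝒲 j' W').Nonempty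
    · left
      obtain ⟨p, hp, x, hx, J, hJ⟩ := h
      intro p' hp'
      -- A chain from `W'` that reaches one point of `G` reaches all of `G` through the additional
      -- link `W`.
      refine ⟨x, hx, max J j, ?_⟩
      exact (reflTransGen_linked_mono le_rfl (le_max_left _ _) hJ).tail
        ⟨j, hlt, le_max_right _ _, W, hW, hnear p hp, hnear p' hp'⟩
    · right
      exact not_nonempty_iff_eq_empty.1 h
  · right
    rw [eq_empty_iff_forall_notMem]
    rintro p ⟨hp, hps⟩
    obtain ⟨y, hy, hpy⟩ := Metric.mem_thickening_iff.1 (hnear p hp)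
    obtain ⟨x, hx, hxp⟩ := exists_near_of_mem_saturation hr hr24 hdiam hsep hps
    have hWW : W ≠ W' := by rintro rfl; exact hne rfl
    have h1 := hsep j' hj' W hW W' hW' hWW y hy x hx
    have h2 := dist_triangle y p x
    rw [dist_comm y p, dist_comm p x] at h2
    have : 0 < r ^ (j' + 1) := by positivity
    linarith

end Saturation

/-- For small parameters there is a sequence of coverings which is adapted to all hyperbolic
approximations. -/
theorem CapacityProperty.exists_isAdapted {n : ℕ} (h : CapacityProperty Z n) {C : Type*}
    [Fintype C] (hC : Fintype.card C = n + 1) (hD : 0 < Metric.diam (univ : Set Z)) :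
    ∃ r₀ : ℝ, 0 < r₀ ∧ ∀ r : ℝ, 0 < r → r < r₀ →
      ∃ 𝒰 : ℕ → C → Set (Set Z), ∀ X : HypApprox Z r, IsAdapted X 𝒰 := by
  obtain ⟨δ, hδ, τ₀, hτ₀, h⟩ := h.exists_separated_cover hC
  have hCne : Nonempty C := Fintype.card_pos_iff.1 (by omega)
  -- The coverings are taken at scale `τ = r ^ j / 2`. The bound `δ / 22` makes their separation `δ
  -- * τ` at least `11 * r ^ (j + 1)`, and `1 / 24` is the bound for chains.
  refine ⟨min (min (Metric.diam (univ : Set Z)) (1 / Metric.diam (univ : Set Z)))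
    (min (min (1 / 24) τ₀) (δ / 22)), by positivity, fun r hr hr0 => ?_⟩
  simp only [lt_min_iff] at hr0
  obtain ⟨⟨hrD, hrD'⟩, ⟨hr24, hrτ⟩, hrδ⟩ := hr0
  have hpow : ∀ j : ℕ, 1 ≤ j → r ^ j ≤ r := fun j hj => by
    simpa using pow_le_pow_of_le_one hr.le (by linarith) hj
  have hex : ∀ j : ℕ, ∃ 𝒲 : C → Set (Set Z), 1 ≤ j →
      (∀ c, ∀ W ∈ 𝒲 c, IsOpen W ∧ W.Nonempty ∧ ∀ x ∈ W, ∀ y ∈ W, dist x y ≤ r ^ j / 2) ∧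
      (∀ c, ∀ W ∈ 𝒲 c, ∀ W' ∈ 𝒲 c, W ≠ W' → ∀ x ∈ W, ∀ y ∈ W', 11 * r ^ (j + 1) ≤ dist x y) ∧
      ∀ z, ∃ c, ∃ W ∈ 𝒲 c, Metric.ball z (2 * r ^ (j + 1)) ⊆ W := by
    intro j
    by_cases hj : 1 ≤ j
    · have hrj : 0 < r ^ j := by positivity
      obtain ⟨𝒲, h1, h2, h3⟩ := h (r ^ j / 2) (by positivity) (by have := hpow j hj; linarith)
      have e : r ^ (j + 1) = r * r ^ j := by ring
      refine ⟨𝒲, fun _ => ⟨h1, fun c W hW W' hW' hne x hx y hy => ?_, fun z => ?_⟩⟩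
      · refine le_trans ?_ (h2 c W hW W' hW' hne x hx y hy)
        rw [e]
        nlinarith
      · obtain ⟨c, W, hW, hz⟩ := h3 z
        refine ⟨c, W, hW, (Metric.ball_subset_ball ?_).trans hz⟩
        rw [e]
        nlinarith
    · exact ⟨fun _ => ∅, fun h => absurd h hj⟩
  choose 𝒲 h𝒲 using hex
  let sat : ℕ → C → Set Z → Set Z := fun j c W => saturation r (fun i => 𝒲 i c) j W
  let 𝒰 : ℕ → C → Set (Set Z) := fun j c => if j = 0 then {univ} else sat j c '' 𝒲 j c
  have hdiam : ∀ c, ∀ j, 1 ≤ j → ∀ W ∈ 𝒲 j c, ∀ x ∈ W, ∀ y ∈ W, dist x y ≤ r ^ j / 2 :=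
    fun c j hj W hW => ((h𝒲 j hj).1 c W hW).2.2
  have hsep : ∀ c, ∀ j, 1 ≤ j → ∀ W ∈ 𝒲 j c, ∀ W' ∈ 𝒲 j c, W ≠ W' → ∀ x ∈ W, ∀ y ∈ W',
      11 * r ^ (j + 1) ≤ dist x y := fun c j hj => (h𝒲 j hj).2.1 c
  have near : ∀ c j, ∀ W, ∀ y ∈ sat j c W, ∃ x ∈ W, dist x y ≤ r ^ (j + 1) := fun c j W y hy =>
    exists_near_of_mem_saturation hr hr24.le (hdiam c) (hsep c) hy
  have sub : ∀ c j W, W ⊆ sat j c W := fun c j W x hx => ⟨x, hx, 0, .refl⟩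
  have h𝒰0 : ∀ c, 𝒰 0 c = {univ} := fun c => if_pos rfl
  have h𝒰 : ∀ j, j ≠ 0 → ∀ c, 𝒰 j c = sat j c '' 𝒲 j c := fun j hj c => if_neg hj
  have hball : ∀ (j : ℕ) (z : Z), ∃ c, ∃ U ∈ 𝒰 j c, Metric.ball z (2 * r ^ (j + 1)) ⊆ U := by
    intro j z
    by_cases hj : j = 0
    · subst hj
      obtain ⟨c⟩ := hCne
      exact ⟨c, univ, by rw [h𝒰0]; rfl, subset_univ _⟩
    · obtain ⟨c, W, hW, hz⟩ := (h𝒲 j (by omega)).2.2 z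
      exact ⟨c, sat j c W, by rw [h𝒰 j hj]; exact ⟨W, hW, rfl⟩, hz.trans (sub c j W)⟩
  -- Formulating separation for all sets close to `U` keeps it free of `X`, so that one sequence of
  -- coverings serves every hyperbolic approximation.
  have hsepU : ∀ (c : C) (j j' : ℕ) (U U' : Set Z), U ∈ 𝒰 j c → U' ∈ 𝒰 j' c → j' ≤ j →
      (j, U) ≠ (j', U') → ∀ G : Set Z, (∀ p ∈ G, ∃ y ∈ U, dist p y < 4 * r ^ (j + 1)) →
      G ⊆ U' ∨ G ∩ U' = ∅ := by
    intro c j j' U U' hU hU' hjj hne G hG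
    by_cases hj' : j' = 0
    · subst hj'
      rw [h𝒰0] at hU'
      obtain rfl : U' = univ := hU'
      exact Or.inl (subset_univ _)
    · rw [h𝒰 j (by omega)] at hU
      rw [h𝒰 j' hj'] at hU'
      obtain ⟨W, hW, rfl⟩ := hU
      obtain ⟨W', hW', rfl⟩ := hU'
      exact saturation_separated hr hr24.le (hdiam c) (hsep c) (by omega) hjj hW hW'
        (fun heq => hne (by simp only [Prod.mk.injEq] at heq ⊢; obtain ⟨rfl, rfl⟩ := heq; simp)) hG
  have hnonempty : ∀ j c, ∀ U ∈ 𝒰 j c, U.Nonempty := by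
    intro j c U hU
    by_cases hj : j = 0
    · subst hj
      rw [h𝒰0] at hU
      obtain rfl : U = univ := hU
      have : Nontrivial Z := by
        by_contra hcon
        rw [not_nontrivial_iff_subsingleton] at hcon
        exact hD.ne' (Metric.diam_subsingleton subsingleton_univ)
      exact univ_nonempty
    · rw [h𝒰 j hj] at hU
      obtain ⟨W, hW, rfl⟩ := hU
      exact (((h𝒲 j (by omega)).1 c W hW).2.1).mono (sub c j W)
  refine ⟨𝒰, fun X => ⟨lt_min hrD hrD', fun j => ⟨?_, ?_, ?_⟩, hnonempty, h𝒰0, ?_, ?_, ?_⟩⟩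
  · intro c U hU
    by_cases hj : j = 0
    · subst hj
      rw [h𝒰0] at hU
      obtain rfl : U = univ := hU
      exact isOpen_univ
    · rw [h𝒰 j hj] at hU
      obtain ⟨W, hW, rfl⟩ := hU
      exact isOpen_saturation ((h𝒲 j (by omega)).1 c W hW).1
  · intro c U hU U' hU' hne
    rw [Function.onFun, disjoint_iff_inter_eq_empty]
    have key := fun G hG => hsepU c j j U U' hU hU' le_rfl (by simpa using hne) G hG
    by_cases hj : j = 0
    · subst hj
      rw [h𝒰0] at hU hU'
      exact absurd (hU.trans hU'.symm) hne
    · have hpos : 0 < r ^ (j + 1) := by positivity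
      by_contra hcon
      obtain ⟨p, hp, hp'⟩ := nonempty_iff_ne_empty.2 hcon
      rw [h𝒰 j hj] at hU hU'
      obtain ⟨W, hW, rfl⟩ := hU
      obtain ⟨W', hW', rfl⟩ := hU'
      obtain ⟨x, hx, hxp⟩ := near _ _ _ _ hp
      obtain ⟨y, hy, hyp⟩ := near _ _ _ _ hp'
      have h1 := hsep c j (by omega) W hW W' hW' (by rintro rfl; exact hne rfl) x hx y hy
      have h2 := dist_triangle_right x y p
      linarith
  · rw [eq_univ_iff_forall]
    intro z
    obtain ⟨c, U, hU, hz⟩ := hball j z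
    exact mem_iUnion.2 ⟨c, U, hU, hz (Metric.mem_ball_self (by positivity))⟩
  · intro j hj
    have hrj : 0 < r ^ j := by positivity
    have e : r ^ (j + 1) = r * r ^ j := by ring
    refine lt_of_le_of_lt (b := ENNReal.ofReal (3 / 4 * r ^ j)) ?_
      ((ENNReal.ofReal_lt_ofReal_iff hrj).2 (by linarith))
    refine iSup_le fun c => iSup₂_le fun U hU => Metric.ediam_le fun x hx y hy => ?_
    rw [h𝒰 j (by omega)] at hU
    obtain ⟨W, hW, rfl⟩ := hU
    obtain ⟨a, ha, hax⟩ := near _ _ _ _ hx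
    obtain ⟨b, hb, hby⟩ := near _ _ _ _ hy
    rw [edist_dist]
    refine ENNReal.ofReal_le_ofReal ?_
    have h1 := hdiam c j hj W hW a ha b hb
    have h2 := dist_triangle4 x a b y
    rw [dist_comm x a] at h2
    nlinarith
  · intro j v hv
    obtain ⟨c, U, hU, hz⟩ := hball j v.point
    refine ⟨c, U, hU, ?_⟩
    rw [HypApprox.Vertex.ball, hv]
    exact_mod_cast hz
  · intro c j j' U U' hU hU' hjj hne
    refine hsepU c j j' U U' hU hU' hjj hne _ fun p hp => ?_
    simp only [HypApprox.hull, mem_iUnion, mem_ofPred_eq] at hp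
    obtain ⟨v, ⟨hv, y, hyv, hyU⟩, hpv⟩ := hp
    -- A ball of radius `2 * r ^ (j + 1)` which meets `U` stays within `4 * r ^ (j + 1)` of it.
    refine ⟨y, hyU, ?_⟩
    rw [HypApprox.Vertex.ball, hv, Metric.mem_ball] at hpv hyv
    have e : r ^ ((j : ℤ) + 1) = r ^ (j + 1) := by exact_mod_cast zpow_natCast r (j + 1)
    rw [e] at hpv hyv
    have := dist_triangle_right p y v.point
    linarith

end Existence

/-! ### Geometry of hyperbolic approximations -/

namespace HypApprox

variable {Z : Type*} [MetricSpace Z] {r : ℝ} {X : HypApprox Z r}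

theorem zpow_anti (X : HypApprox Z r) {a b : ℤ} (h : a ≤ b) : r ^ b ≤ r ^ a :=
  zpow_le_zpow_right_of_le_one₀ X.r_pos (by linarith [X.r_le]) h

theorem zpow_succ_le (X : HypApprox Z r) (k : ℤ) : 6 * r ^ (k + 1) ≤ r ^ k := by
  rw [zpow_add_one₀ X.r_pos.ne']
  nlinarith [zpow_pos X.r_pos k, X.r_le]

/-- Compared with `exists_mem_ball`, half the radius suffices. The gain is the room needed to put
balls of level `k + 1` into balls of level `k`. -/
theorem exists_dist_lt (X : HypApprox Z r) (z : Z) (k : ℤ) (hk : X.k₀ ≤ k) :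
    ∃ v : X.Vertex, v.level = k ∧ dist z v.point < r ^ k := by
  have hr : 0 < r ^ k := zpow_pos X.r_pos k
  by_contra! hcon
  have hfar : ∀ x ∈ X.net k, r ^ k ≤ dist z x := fun x hx => hcon ⟨(k, x), hk, hx⟩ rfl
  have hz : z ∉ X.net k := fun h => by
    have := hfar z h
    rw [dist_self] at this
    linarith
  have hsep : IsSep (r ^ k) (insert z (X.net k)) := by
    refine (X.maximal_net k hk).prop.insert ?_
    intro x hx _
    exact ⟨hfar x hx, by rw [dist_comm]; exact hfar x hx⟩
  exact hz ((X.maximal_net k hk).le_of_ge hsep (subset_insert _ _) (mem_insert _ _))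

theorem Vertex.point_mem_ball (v : X.Vertex) : v.point ∈ v.ball :=
  Metric.mem_ball_self (by have := zpow_pos X.r_pos v.level; positivity)

theorem Vertex.point_mem_closedBall (v : X.Vertex) : v.point ∈ v.closedBall :=
  Metric.ball_subset_closedBall v.point_mem_ball

/-- Vertices of level `k + 1` joined by a horizontal edge have a common neighbor of level `k`. -/
theorem exists_lower (v w : X.Vertex) (k : ℤ) (hk : X.k₀ ≤ k) (hv : v.level = k + 1)
    (hw : w.level = k + 1) (h : (v.closedBall ∩ w.closedBall).Nonempty) :
    ∃ u : X.Vertex, u.level = k ∧ dist v.point u.point < r ^ k ∧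
      v.ball ⊆ u.ball ∧ w.ball ⊆ u.ball := by
  obtain ⟨u, hu, hd⟩ := X.exists_dist_lt v.point k hk
  obtain ⟨z, hzv, hzw⟩ := h
  rw [Vertex.closedBall, Metric.mem_closedBall, hv] at hzv
  rw [Vertex.closedBall, Metric.mem_closedBall, hw] at hzw
  have h6 := X.zpow_succ_le k
  have hpos := zpow_pos X.r_pos (k + 1)
  refine ⟨u, hu, hd, Metric.ball_subset_ball' ?_, Metric.ball_subset_ball' ?_⟩
  · rw [hu, hv]
    linarith
  -- The centers are at most `4 * r ^ (k + 1)` apart and the radius adds `2 * r ^ (k + 1)`; the sum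
  -- fits into `r ^ k` because `r ≤ 1 / 6`.
  · rw [hu, hw]
    have := dist_triangle4 w.point z v.point u.point
    rw [dist_comm w.point z] at this
    linarith

theorem exists_lower_self (v : X.Vertex) (k : ℤ) (hk : X.k₀ ≤ k) (hv : v.level = k + 1) :
    ∃ u : X.Vertex, u.level = k ∧ dist v.point u.point < r ^ k ∧ v.ball ⊆ u.ball := by
  obtain ⟨u, h1, h2, h3, -⟩ := exists_lower v v k hk hv hv
    ⟨v.point, v.point_mem_closedBall, v.point_mem_closedBall⟩
  exact ⟨u, h1, h2, h3⟩

theorem adj_of_ball_subset {v u : X.Vertex} (hl : v.level = u.level + 1) (hb : v.ball ⊆ u.ball) :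
    X.graph.Adj v u :=
  ⟨by rintro rfl; omega, Or.inr (Or.inr ⟨hl, hb⟩)⟩

theorem exists_walk_lower (v : X.Vertex) (j : ℤ) (hj : X.k₀ ≤ j) (hjv : j ≤ v.level) :
    ∃ w : X.Vertex, w.level = j ∧ v.ball ⊆ w.ball ∧
      ∃ p : X.graph.Walk v w, (p.length : ℤ) = v.level - j := by
  obtain ⟨d, hd⟩ : ∃ d : ℕ, v.level = j + d := ⟨(v.level - j).toNat, by omega⟩
  induction d generalizing v with
  | zero => exact ⟨v, by simpa using hd, subset_rfl, .nil, by simp [hd]⟩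
  | succ d ih =>
    obtain ⟨u, hu, -, hb⟩ := exists_lower_self v (j + d) (by omega) (by push_cast at hd; omega)
    obtain ⟨w, hw, hbw, p, hp⟩ := ih u (by omega) hu
    refine ⟨w, hw, hb.trans hbw, .cons (adj_of_ball_subset (by push_cast at hd; omega) hb) p, ?_⟩
    rw [SimpleGraph.Walk.length_cons]
    push_cast at hd ⊢
    omega

theorem eq_of_level_eq_k₀ (hbounded : Bornology.IsBounded (univ : Set Z)) {v w : X.Vertex}
    (hv : v.level = X.k₀) (hw : w.level = X.k₀) : v = w := by
  have hp : v.point = w.point := by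
    by_contra hne
    have h1 : r ^ X.k₀ ≤ dist v.point w.point :=
      (X.maximal_net X.k₀ le_rfl).prop (hv ▸ v.2.2) (hw ▸ w.2.2) hne
    have h2 := Metric.dist_le_diam_of_mem hbounded (mem_univ v.point) (mem_univ w.point)
    have h3 : Metric.diam (univ : Set Z) < r ^ X.k₀ := X.isGreatest_k₀.1
    linarith
  exact Subtype.ext (Prod.ext (hv.trans hw.symm) hp)

theorem graph_connected [Nonempty Z] (hbounded : Bornology.IsBounded (univ : Set Z)) :
    X.graph.Connected := by
  obtain ⟨z⟩ := ‹Nonempty Z›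
  obtain ⟨v₀, hv₀, -⟩ := X.exists_dist_lt z X.k₀ le_rfl
  have : ∀ v : X.Vertex, X.graph.Reachable v v₀ := fun v => by
    obtain ⟨w, hw, -, p, -⟩ := exists_walk_lower v X.k₀ le_rfl v.2.1
    obtain rfl := eq_of_level_eq_k₀ hbounded hw hv₀
    exact ⟨p⟩
  have : Nonempty X.Vertex := ⟨v₀⟩
  exact ⟨fun u v => (‹∀ v, X.graph.Reachable v v₀› u).trans (‹∀ v, X.graph.Reachable v v₀› v).symm⟩

/-- At level `l - 1` vertices below `v` and `v'` have intersecting closed balls, so a single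
horizontal edge suffices; it costs three edges beyond the levels. If `l = k₀`, both descents end at
the same vertex. -/
theorem dist_le_of_dist_point_le [Nonempty Z] (hbounded : Bornology.IsBounded (univ : Set Z))
    (v v' : X.Vertex) (l : ℤ) (hl : X.k₀ ≤ l) (hlv : l ≤ v.level) (hlv' : l ≤ v'.level)
    (hd : dist v.point v'.point ≤ 5 / 3 * r ^ l) :
    (X.graph.dist v v' : ℤ) ≤ v.level + v'.level - 2 * l + 3 := by
  have hconn := graph_connected (X := X) hbounded
  obtain ⟨w, hw, hb, p, hp⟩ := exists_walk_lower v l hl hlv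
  by_cases h0 : l = X.k₀
  · obtain ⟨w', hw', hb', p', hp'⟩ := exists_walk_lower v' l hl hlv'
    obtain rfl := eq_of_level_eq_k₀ hbounded (hw.trans h0) (hw'.trans h0)
    have := SimpleGraph.dist_le (p.append p'.reverse)
    simp only [SimpleGraph.Walk.length_append, SimpleGraph.Walk.length_reverse] at this
    omega
  · obtain ⟨u, hu, hdu, hbu⟩ := exists_lower_self w (l - 1) (by omega) (by omega)
    obtain ⟨u', hu', hb', p', hp'⟩ := exists_walk_lower v' (l - 1) (by omega) (by omega)
    have h1 := SimpleGraph.dist_le p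
    have h2 : X.graph.dist w u ≤ 1 :=
      (SimpleGraph.dist_eq_one_iff_adj.2 (adj_of_ball_subset (by omega) hbu)).le
    have h3 : X.graph.dist u u' ≤ 1 := by
      by_cases huu : u = u'
      · simp [huu]
      refine (SimpleGraph.dist_eq_one_iff_adj.2 (?_ : X.graph.Adj u u')).le
      refine ⟨huu, Or.inl ⟨by omega, v'.point, ?_,
        Metric.ball_subset_closedBall (hb' v'.point_mem_ball)⟩⟩
      rw [Vertex.closedBall, Metric.mem_closedBall, hu]
      have hx := hb v.point_mem_ball
      rw [Vertex.ball, Metric.mem_ball, hw] at hx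
      have h6 := X.zpow_succ_le (l - 1)
      rw [sub_add_cancel] at h6
      have h7 := dist_triangle4 v'.point v.point w.point u.point
      rw [dist_comm v'.point v.point] at h7
      have := zpow_pos X.r_pos l
      linarith
    have h4 := SimpleGraph.dist_le p'
    rw [SimpleGraph.dist_comm] at h4
    have t1 := hconn.dist_triangle (u := v) (v := w) (w := v')
    have t2 := hconn.dist_triangle (u := w) (v := u) (w := v')
    have t3 := hconn.dist_triangle (u := u) (v := u') (w := v')
    omega

end HypApprox

/-! ### Geometry of the colored trees -/

namespace TreeVertex

variable {Z C : Type*} {𝒰 : ℕ → C → Set (Set Z)} {c : C}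

/-- `W` is `U` or an ancestor of `U`. -/
def Above (W U : TreeVertex 𝒰 c) : Prop := W = U ∨ IsAncestor W U

theorem Above.subset {W U : TreeVertex 𝒰 c} (h : Above W U) : U.carrier ⊆ W.carrier := by
  rcases h with rfl | h
  · exact subset_rfl
  · exact h.2

theorem Above.index_le {W U : TreeVertex 𝒰 c} (h : Above W U) : W.index ≤ U.index := by
  rcases h with rfl | h
  · exact le_rfl
  · exact h.1.le

theorem Above.trans {W U T : TreeVertex 𝒰 c} (h : Above W U) (h' : Above U T) : Above W T := by
  rcases h with rfl | h
  · exact h'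
  · exact Or.inr ⟨h.1.trans_le h'.index_le, h'.subset.trans h.2⟩

theorem level_of_ne {k₀ : ℤ} {U : TreeVertex 𝒰 c} (h : U.index ≠ 0) : U.level k₀ = U.index :=
  if_neg h

theorem level_of_eq {k₀ : ℤ} {U : TreeVertex 𝒰 c} (h : U.index = 0) : U.level k₀ = k₀ :=
  if_pos h

end TreeVertex

open TreeVertex

namespace IsAdapted

variable {Z C : Type*} [MetricSpace Z] {r : ℝ} {X : HypApprox Z r} {𝒰 : ℕ → C → Set (Set Z)}
  {F : Type*} {c : C}

theorem carrier_nonempty (h : IsAdapted X 𝒰) (U : TreeVertex 𝒰 c) : U.carrier.Nonempty :=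
  h.nonempty _ _ _ U.2

theorem subset_hull (h : IsAdapted X 𝒰) (j : ℕ) (U : Set Z) : U ⊆ X.hull j U := by
  intro z hz
  obtain ⟨v, hv, hzv⟩ := X.exists_mem_ball z ((j : ℤ) + 1) (by have := h.k₀_nonpos; omega)
  exact mem_iUnion₂.2 ⟨v, ⟨hv, z, hzv, hz⟩, hzv⟩

theorem ball_subset_hull {j : ℕ} {U : Set Z} {v : X.Vertex} (hv : v.level = (j : ℤ) + 1)
    (h : (v.ball ∩ U).Nonempty) : v.ball ⊆ X.hull j U :=
  subset_iUnion₂_of_subset v ⟨hv, h⟩ subset_rfl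

/-- An ancestor contains not only `U` but a neighborhood of it. Balls that merely meet `U` are
thereby controlled. -/
theorem hull_subset (h : IsAdapted X 𝒰) {W U : TreeVertex 𝒰 c} (hWU : IsAncestor W U) :
    X.hull U.index U.carrier ⊆ W.carrier := by
  rcases h.separation c U.index W.index U.carrier W.carrier U.2 W.2 hWU.1.le
    (fun heq => hWU.1.ne' (congrArg Prod.fst heq)) with h1 | h1
  · exact h1
  · obtain ⟨z, hz⟩ := h.carrier_nonempty U
    have : z ∈ X.hull U.index U.carrier ∩ W.carrier := ⟨h.subset_hull _ _ hz, hWU.2 hz⟩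
    rw [h1] at this
    exact absurd this (notMem_empty z)

/-- Members of one color that meet are nested, since separation excludes anything else and members
of the same index are disjoint. Consequently the ancestors of a vertex form a single path. -/
theorem above_of_mem (h : IsAdapted X 𝒰) {W U : TreeVertex 𝒰 c} {z : Z} (hW : z ∈ W.carrier)
    (hU : z ∈ U.carrier) (hle : W.index ≤ U.index) : Above W U := by
  by_cases heq : W = U
  · exact Or.inl heq
  have hne : (U.index, U.carrier) ≠ (W.index, W.carrier) := fun h => heq (Subtype.ext h.symm)
  have hsub : U.carrier ⊆ W.carrier := by
    rcases h.separation c U.index W.index U.carrier W.carrier U.2 W.2 hle hne with h1 | h1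
    · exact (h.subset_hull _ _).trans h1
    · have : z ∈ X.hull U.index U.carrier ∩ W.carrier := ⟨h.subset_hull _ _ hU, hW⟩
      rw [h1] at this
      exact absurd this (notMem_empty z)
  refine Or.inr ⟨lt_of_le_of_ne hle fun hi => hne ?_, hsub⟩
  by_contra hne'
  have hc : W.carrier ≠ U.carrier := fun hc => hne (Prod.ext hi.symm hc.symm)
  have := (h.isCover U.index).disjoint c (hi ▸ W.2 : W.carrier ∈ 𝒰 U.index c) U.2 hc
  exact disjoint_left.1 this hW hU

theorem dist_lt_of_mem (h : IsAdapted X 𝒰) {W : TreeVertex 𝒰 c} (hW : W.index ≠ 0) {x y : Z}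
    (hx : x ∈ W.carrier) (hy : y ∈ W.carrier) : dist x y < r ^ W.index := by
  have h1 : edist x y < ENNReal.ofReal (r ^ W.index) := by
    refine lt_of_le_of_lt ?_ (h.mesh_lt W.index (by omega))
    refine (Metric.edist_le_ediam_of_mem hx hy).trans ?_
    exact le_iSup_of_le c (le_iSup₂_of_le W.carrier W.2 le_rfl)
  rw [edist_dist] at h1
  exact (ENNReal.ofReal_lt_ofReal_iff (pow_pos X.r_pos _)).1 h1

/-- The path from the root (not listed) to `U`. -/
noncomputable def chain (h : IsAdapted X 𝒰) (U : TreeVertex 𝒰 c) : List (TreeVertex 𝒰 c) :=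
  if hU : U.index = 0 then [] else h.chain (h.parent U hU) ++ [U]
termination_by U.index
decreasing_by exact (h.parent_spec U hU).1.1

theorem chain_of_eq (h : IsAdapted X 𝒰) {U : TreeVertex 𝒰 c} (hU : U.index = 0) :
    h.chain U = [] := by
  rw [chain, dif_pos hU]

theorem chain_of_ne (h : IsAdapted X 𝒰) {U : TreeVertex 𝒰 c} (hU : U.index ≠ 0) :
    h.chain U = h.chain (h.parent U hU) ++ [U] := by
  rw [chain, dif_neg hU]

theorem sentence_of_eq (h : IsAdapted X 𝒰) (μ : X.Vertex → F) {U : TreeVertex 𝒰 c}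
    (hU : U.index = 0) : h.sentence μ U = [] := by
  rw [sentence, dif_pos hU]

theorem sentence_of_ne (h : IsAdapted X 𝒰) (μ : X.Vertex → F) {U : TreeVertex 𝒰 c}
    (hU : U.index ≠ 0) : h.sentence μ U = h.sentence μ (h.parent U hU) ++
      [(h.edgeWord μ (h.parent U hU) U, stopSign X F U)] := by
  rw [sentence, dif_neg hU]

/-- Induction along the path from the root. -/
theorem tree_induction (h : IsAdapted X 𝒰) {p : TreeVertex 𝒰 c → Prop}
    (h0 : ∀ U, U.index = 0 → p U)
    (h1 : ∀ U (hU : U.index ≠ 0), p (h.parent U hU) → p U) (U : TreeVertex 𝒰 c) : p U := by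
  by_cases hU : U.index = 0
  · exact h0 U hU
  · exact h1 U hU (h.tree_induction h0 h1 (h.parent U hU))
termination_by U.index
decreasing_by exact (h.parent_spec U hU).1.1

theorem above_parent (h : IsAdapted X 𝒰) {W U : TreeVertex 𝒰 c} (hU : U.index ≠ 0)
    (hWU : IsAncestor W U) : Above W (h.parent U hU) := by
  obtain ⟨hP, hmax⟩ := h.parent_spec U hU
  obtain ⟨z, hz⟩ := h.carrier_nonempty U
  exact h.above_of_mem (hWU.2 hz) (hP.2 hz) (hmax W hWU)

theorem chain_prefix (h : IsAdapted X 𝒰) {W U : TreeVertex 𝒰 c} (hWU : Above W U) :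
    h.chain W <+: h.chain U := by
  induction U using h.tree_induction with
  | h0 U hU =>
    rcases hWU with rfl | hWU
    · exact List.prefix_rfl
    · have := hWU.1
      omega
  | h1 U hU ih =>
    rcases hWU with rfl | hWU
    · exact List.prefix_rfl
    · rw [h.chain_of_ne hU]
      exact (ih (h.above_parent hU hWU)).trans (List.prefix_append _ _)

theorem mem_chain (h : IsAdapted X 𝒰) {W U : TreeVertex 𝒰 c} :
    W ∈ h.chain U ↔ W.index ≠ 0 ∧ Above W U := by
  induction U using h.tree_induction with
  | h0 U hU =>
    rw [h.chain_of_eq hU]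
    simp only [List.not_mem_nil, false_iff, not_and]
    intro hW hWU
    have := hWU.index_le
    omega
  | h1 U hU ih =>
    rw [h.chain_of_ne hU, List.mem_append, ih, List.mem_singleton]
    constructor
    · rintro (⟨h1, h2⟩ | rfl)
      · exact ⟨h1, h2.trans (Or.inr (h.parent_spec U hU).1)⟩
      · exact ⟨hU, Or.inl rfl⟩
    · rintro ⟨h1, rfl | h2⟩
      · exact Or.inr rfl
      · exact Or.inl ⟨h1, h.above_parent hU h2⟩

theorem chain_sorted (h : IsAdapted X 𝒰) (U : TreeVertex 𝒰 c) :
    (h.chain U).Pairwise fun W W' => W.index < W'.index := by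
  induction U using h.tree_induction with
  | h0 U hU =>
    rw [h.chain_of_eq hU]
    exact List.Pairwise.nil
  | h1 U hU ih =>
    rw [h.chain_of_ne hU, List.pairwise_append]
    refine ⟨ih, List.pairwise_singleton _ _, fun W hW W' hW' => ?_⟩
    rw [List.mem_singleton.1 hW']
    exact (h.mem_chain.1 hW).2.index_le.trans_lt (h.parent_spec U hU).1.1

/-- Initial segments of a path are paths of its vertices; the strictly increasing indices fix the
position of each vertex. -/
theorem chain_getElem (h : IsAdapted X 𝒰) (U : TreeVertex 𝒰 c) (n : ℕ)
    (hn : n < (h.chain U).length) : h.chain (h.chain U)[n] = (h.chain U).take (n + 1) := by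
  set W := (h.chain U)[n] with hW
  have hWm : W ∈ h.chain U := List.getElem_mem hn
  obtain ⟨hW0, hWU⟩ := h.mem_chain.1 hWm
  have hpre := h.chain_prefix hWU
  rw [h.chain_of_ne hW0] at hpre ⊢
  set A := h.chain (h.parent W hW0)
  obtain ⟨B, hB⟩ := hpre
  have hlt : A.length < (h.chain U).length := by rw [← hB]; simp
  have h1 : (h.chain U)[A.length] = W := by
    simp [← hB]
  have hs := List.pairwise_iff_getElem.1 (h.chain_sorted U)
  have hAn : A.length = n := by
    rcases lt_trichotomy A.length n with hl | hl | hl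
    · have := hs _ _ hlt hn hl
      rw [h1, ← hW] at this
      omega
    · exact hl
    · have := hs _ _ hn hlt hl
      rw [h1, ← hW] at this
      omega
  rw [← hB, ← hAn, List.take_left' (by simp)]

open Classical in
/-- The last word of the sentence of `W`, with its stop sign. -/
noncomputable def lastWord (h : IsAdapted X 𝒰) (μ : X.Vertex → F) (W : TreeVertex 𝒰 c) :
    List (Letter F) × Letter F :=
  if hW : W.index = 0 then ([], stopSign X F W)
  else (h.edgeWord μ (h.parent W hW) W, stopSign X F W)

/-- A word depends only on the vertex at its end. So initial parts of paths give initial parts of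
sentences, and of diaries. -/
theorem sentence_eq_map (h : IsAdapted X 𝒰) (μ : X.Vertex → F) (U : TreeVertex 𝒰 c) :
    h.sentence μ U = (h.chain U).map (h.lastWord μ) := by
  induction U using h.tree_induction with
  | h0 U hU => rw [h.sentence_of_eq μ hU, h.chain_of_eq hU, List.map_nil]
  | h1 U hU ih =>
    rw [h.sentence_of_ne μ hU, h.chain_of_ne hU, List.map_append, ih]
    simp [lastWord, hU]

theorem level_parent_lt (h : IsAdapted X 𝒰) {U : TreeVertex 𝒰 c} (hU : U.index ≠ 0) :
    (h.parent U hU).level X.k₀ < U.level X.k₀ := by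
  have h1 := (h.parent_spec U hU).1.1
  have h2 := h.k₀_nonpos
  rw [level_of_ne hU]
  unfold TreeVertex.level
  split_ifs <;> omega

theorem length_edgeWord (h : IsAdapted X 𝒰) (μ : X.Vertex → F) (U' U : TreeVertex 𝒰 c) :
    (h.edgeWord μ U' U).length = (U.level X.k₀ - U'.level X.k₀).toNat := by
  simp [edgeWord]

theorem flat_sentence_of_ne (h : IsAdapted X 𝒰) (μ : X.Vertex → F) {U : TreeVertex 𝒰 c}
    (hU : U.index ≠ 0) : flat (h.sentence μ U) =
      flat (h.sentence μ (h.parent U hU)) ++ h.edgeWord μ (h.parent U hU) U := by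
  rw [h.sentence_of_ne μ hU]
  simp [flat]

theorem length_flat_sentence (h : IsAdapted X 𝒰) (μ : X.Vertex → F) (U : TreeVertex 𝒰 c) :
    ((flat (h.sentence μ U)).length : ℤ) = U.level X.k₀ - X.k₀ := by
  induction U using h.tree_induction with
  | h0 U hU =>
    rw [h.sentence_of_eq μ hU, level_of_eq hU]
    simp [flat]
  | h1 U hU ih =>
    have := h.level_parent_lt hU
    rw [h.flat_sentence_of_ne μ hU, List.length_append, length_edgeWord]
    push_cast
    rw [ih]
    omega

theorem weight_sentence (h : IsAdapted X 𝒰) (μ : X.Vertex → F) (U : TreeVertex 𝒰 c) :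
    (weight (h.sentence μ U) : ℤ) = U.level X.k₀ - X.k₀ + (h.chain U).length := by
  have key : ∀ α : List (List (Letter F) × Letter F),
      weight α = (flat α).length + α.length := by
    intro α
    induction α with
    | nil => rfl
    | cons p α ih =>
      simp only [weight, flat, List.map_cons, List.sum_cons, List.flatMap_cons,
        List.length_append, List.length_cons] at ih ⊢
      omega
  have h1 := h.length_flat_sentence μ U
  have h2 : (h.sentence μ U).length = (h.chain U).length := by
    rw [h.sentence_eq_map, List.length_map]
  rw [key, h2]
  push_cast
  rw [h1]

theorem stopsMarked_sentence (h : IsAdapted X 𝒰) (μ : X.Vertex → F) (U : TreeVertex 𝒰 c) :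
    StopsMarked (fun x : Letter F => x.1.isNone = true) (h.sentence μ U) := by
  intro p hp
  rw [h.sentence_eq_map, List.mem_map] at hp
  obtain ⟨W, hW, rfl⟩ := hp
  have hW0 := (h.mem_chain.1 hW).1
  simp only [lastWord, dif_neg hW0]
  refine ⟨fun x hx => ?_, rfl⟩
  rw [edgeWord, List.mem_ofFn] at hx
  obtain ⟨i, rfl⟩ := hx
  simp

/-- The letter of level `k` of the sentence of `U`. -/
theorem exists_letter (h : IsAdapted X 𝒰) (μ : X.Vertex → F) (U : TreeVertex 𝒰 c) (k : ℤ)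
    (hk : X.k₀ < k) (hkU : k ≤ U.level X.k₀) :
    ∃ W : TreeVertex 𝒰 c, Above W U ∧ k ≤ W.level X.k₀ ∧
      (flat (h.sentence μ U))[(k - X.k₀ - 1).toNat]? =
        some (some (h.colorSet μ W k hk.le), morseThue k.toNat) := by
  induction U using h.tree_induction with
  | h0 U hU =>
    rw [level_of_eq hU] at hkU
    omega
  | h1 U hU ih =>
    rw [h.flat_sentence_of_ne μ hU]
    have hlen := h.length_flat_sentence μ (h.parent U hU)
    by_cases hkP : k ≤ (h.parent U hU).level X.k₀
    · obtain ⟨W, h1, h2, h3⟩ := ih hkP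
      refine ⟨W, h1.trans (Or.inr (h.parent_spec U hU).1), h2, ?_⟩
      rw [List.getElem?_append_left (by omega), h3]
    · refine ⟨U, Or.inl rfl, hkU, ?_⟩
      have hP := h.k₀_le_level (h.parent U hU)
      rw [List.getElem?_append_right (by omega)]
      obtain ⟨i, rfl⟩ : ∃ i : ℕ, k = (h.parent U hU).level X.k₀ + 1 + i :=
        ⟨(k - (h.parent U hU).level X.k₀ - 1).toNat, by omega⟩
      have hi : ((h.parent U hU).level X.k₀ + 1 + i - X.k₀ - 1).toNat -
          (flat (h.sentence μ (h.parent U hU))).length = i := by omega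
      rw [hi, edgeWord, List.getElem?_ofFn, dif_pos (by omega)]

theorem isImage_colorMap (h : IsAdapted X 𝒰) (c : C) (v : X.Vertex) (hv : v.level ≠ X.k₀) :
    IsImage v (h.colorMap c v) := by
  rw [colorMap, dif_neg hv]
  exact (h.exists_isImage c v hv).choose_spec

/-- By nestedness the ancestors of the maximal admissible member are all the other admissible ones.
Every later comparison of the paths of two vertices goes through this description. -/
theorem mem_chain_colorMap (h : IsAdapted X 𝒰) (v : X.Vertex) (W : TreeVertex 𝒰 c) :
    W ∈ h.chain (h.colorMap c v) ↔
      W.index ≠ 0 ∧ v.ball ⊆ W.carrier ∧ (W.index : ℤ) ≤ v.level - 1 := by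
  have hk := h.k₀_nonpos
  by_cases hv : v.level = X.k₀
  · rw [colorMap, dif_pos hv, h.chain_of_eq rfl]
    simp only [List.not_mem_nil, false_iff]
    rintro ⟨-, -, h3⟩
    omega
  · obtain ⟨⟨h1, h2⟩, h3⟩ := h.isImage_colorMap c v hv
    rw [h.mem_chain]
    constructor
    · rintro ⟨h4, h5⟩
      refine ⟨h4, h1.trans h5.subset, ?_⟩
      have h6 := h5.index_le
      rw [level_of_ne (by omega)] at h2
      omega
    · rintro ⟨h4, h5, h6⟩
      refine ⟨h4, h.above_of_mem (h5 v.point_mem_ball) (h1 v.point_mem_ball) ?_⟩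
      have h7 := h3 W h5 (by rw [level_of_ne h4]; exact h6)
      rw [level_of_ne h4] at h7
      by_contra! hcon
      by_cases h8 : (h.colorMap c v).index = 0
      · rw [level_of_eq h8] at h7
        omega
      · rw [level_of_ne h8] at h7
        omega

/-! ### The upper bound -/

/-- The diaries of the ends of a radial edge differ by at most two pages. -/
theorem diary_dist_le_of_ball_subset (h : IsAdapted X 𝒰) (μ : X.Vertex → F) (κ : ℕ)
    {v v' : X.Vertex} (hl : v'.level = v.level + 1) (hb : v'.ball ⊆ v.ball) (c : C) :
    (wordTree _).dist (diary κ (h.sentence μ (h.colorMap c v)))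
      (diary κ (h.sentence μ (h.colorMap c v'))) ≤ 2 := by
  set U := h.colorMap c v with hU
  set U' := h.colorMap c v' with hU'
  have hk := h.k₀_nonpos
  have hpre : h.chain U <+: h.chain U' := by
    by_cases hU0 : U.index = 0
    · rw [h.chain_of_eq hU0]
      exact List.nil_prefix
    · have h1 : U ∈ h.chain U := h.mem_chain.2 ⟨hU0, Or.inl rfl⟩
      rw [hU, h.mem_chain_colorMap, ← hU] at h1
      have h2 : U ∈ h.chain U' := by
        rw [hU', h.mem_chain_colorMap]
        exact ⟨h1.1, hb.trans h1.2.1, by omega⟩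
      exact h.chain_prefix (h.mem_chain.1 h2).2
  -- The grandparent `G` of `U'` is already on the path of `v`. A ball of level `P.index + 1`
  -- containing `B(v)` meets the parent `P`, hence lies in `B(P)` and so in `G`.
  have hlen : (h.chain U').length ≤ (h.chain U).length + 2 := by
    by_cases h0 : U'.index = 0
    · simp [h.chain_of_eq h0]
    set P := h.parent U' h0 with hP
    rw [h.chain_of_ne h0, List.length_append]
    by_cases h1 : P.index = 0
    · simp [← hP, h.chain_of_eq h1]
    set G := h.parent P h1 with hG
    rw [← hP, h.chain_of_ne h1, List.length_append]
    suffices (h.chain G).length ≤ (h.chain U).length by simpa [← hG] using this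
    by_cases h2 : G.index = 0
    · simp [h.chain_of_eq h2]
    have hPU := (h.parent_spec U' h0).1
    have hGP := (h.parent_spec P h1).1
    rw [← hP] at hPU
    rw [← hG] at hGP
    have hU'm : U' ∈ h.chain U' := h.mem_chain.2 ⟨h0, Or.inl rfl⟩
    rw [hU', h.mem_chain_colorMap, ← hU'] at hU'm
    have i1 := hPU.1
    have i2 := hGP.1
    have hGm : G ∈ h.chain U := by
      rw [hU, h.mem_chain_colorMap]
      refine ⟨h2, ?_, by omega⟩
      obtain ⟨w, hw, hbw, -⟩ := HypApprox.exists_walk_lower v ((P.index : ℤ) + 1) (by omega)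
        (by omega)
      refine hbw.trans ((ball_subset_hull hw ⟨v'.point, ?_, ?_⟩).trans (h.hull_subset hGP))
      · exact hbw (hb v'.point_mem_ball)
      · exact hPU.2 (hU'm.2.1 v'.point_mem_ball)
    exact (h.chain_prefix (h.mem_chain.1 hGm).2).length_le
  have hpre' : diary κ (h.sentence μ U) <+: diary κ (h.sentence μ U') := by
    refine diary_prefix ?_
    rw [h.sentence_eq_map, h.sentence_eq_map]
    exact hpre.map _
  obtain ⟨E, hE⟩ := hpre'
  rw [← hE]
  refine (wordTree_dist_append_le _ E).trans ?_
  have := congrArg List.length hE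
  rw [List.length_append, length_diary, length_diary, h.sentence_eq_map, h.sentence_eq_map,
    List.length_map, List.length_map] at this
  omega

theorem diary_dist_le_of_adj (h : IsAdapted X 𝒰) (hbounded : Bornology.IsBounded (univ : Set Z))
    (μ : X.Vertex → F) (κ : ℕ) {v v' : X.Vertex} (hadj : X.graph.Adj v v') (c : C) :
    (wordTree _).dist (diary κ (h.sentence μ (h.colorMap c v)))
      (diary κ (h.sentence μ (h.colorMap c v'))) ≤ 4 := by
  obtain ⟨hne, ⟨hl, hmeet⟩ | ⟨hl, hb⟩ | ⟨hl, hb⟩⟩ := hadj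
  · have hv : v.level ≠ X.k₀ := fun h0 =>
      hne (HypApprox.eq_of_level_eq_k₀ hbounded h0 (hl ▸ h0))
    have hv' : X.k₀ ≤ v.level := v.2.1
    obtain ⟨u, hu, -, hb, hb'⟩ := HypApprox.exists_lower v v' (v.level - 1) (by omega) (by omega)
      (by omega) hmeet
    have h1 := h.diary_dist_le_of_ball_subset μ κ (by omega) hb c
    have h2 := h.diary_dist_le_of_ball_subset μ κ (by omega) hb' c
    rw [SimpleGraph.dist_comm] at h1
    have := wordTree_connected.dist_triangle (u := diary κ (h.sentence μ (h.colorMap c v)))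
      (v := diary κ (h.sentence μ (h.colorMap c u)))
      (w := diary κ (h.sentence μ (h.colorMap c v')))
    omega
  · have := h.diary_dist_le_of_ball_subset μ κ hl hb c
    omega
  · have := h.diary_dist_le_of_ball_subset μ κ hl hb c
    rw [SimpleGraph.dist_comm] at this
    omega

theorem diary_dist_le (h : IsAdapted X 𝒰) (hbounded : Bornology.IsBounded (univ : Set Z))
    (μ : X.Vertex → F) (κ : ℕ) {v v' : X.Vertex} (p : X.graph.Walk v v') (c : C) :
    (wordTree _).dist (diary κ (h.sentence μ (h.colorMap c v)))
      (diary κ (h.sentence μ (h.colorMap c v'))) ≤ 4 * p.length := by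
  induction p with
  | nil => simp
  | @cons v u v' hadj p ih =>
    have h1 := h.diary_dist_le_of_adj hbounded μ κ hadj c
    have := wordTree_connected.dist_triangle (u := diary κ (h.sentence μ (h.colorMap c v)))
      (v := diary κ (h.sentence μ (h.colorMap c u)))
      (w := diary κ (h.sentence μ (h.colorMap c v')))
    rw [SimpleGraph.Walk.length_cons]
    omega

end IsAdapted

/-! ### The lower bound -/

/-- Long equal factors of the Morse-Thue sequence at a small shift have shift zero. -/
theorem eq_of_morseThue_eq {a b R : ℕ} (ha : R ≤ a + 1) (hb : R ≤ b + 1)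
    (hab : 2 * (b - a) ≤ R) (hba : 2 * (a - b) ≤ R)
    (h : ∀ x < R, morseThue (a - x) = morseThue (b - x)) : a = b := by
  have key : ∀ {a b : ℕ}, R ≤ a + 1 → 2 * (b - a) ≤ R →
      (∀ x < R, morseThue (a - x) = morseThue (b - x)) → ¬ a < b := by
    intro a b ha hab h hlt
    -- A positive shift would produce a cube with period `b - a` ending at position `b`.
    refine morseThue_cube_free (b - a) (by omega) (a + 1 - 2 * (b - a)) fun k h1 h2 => ?_
    have := h (a - k) (by omega)
    rwa [show a - (a - k) = k by omega, show b - (a - k) = k + (b - a) by omega] at this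
  have h1 := key ha hab h
  have h2 := key hb hba fun x hx => (h x hx).symm
  omega

theorem exists_common_prefix_heads_ne {α : Type*} (s t : List α) :
    ∃ P s' t', s = P ++ s' ∧ t = P ++ t' ∧ ∀ a s'' t'', s' = a :: s'' → t' = a :: t'' → False := by
  induction s generalizing t with
  | nil => exact ⟨[], [], t, rfl, rfl, by simp⟩
  | cons a s ih =>
    rcases t with _ | ⟨b, t⟩
    · exact ⟨[], a :: s, [], rfl, rfl, by simp⟩
    by_cases hab : a = b
    · subst hab
      obtain ⟨P, s', t', rfl, rfl, h⟩ := ih t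
      exact ⟨a :: P, s', t', rfl, rfl, h⟩
    · refine ⟨[], a :: s, b :: t, rfl, rfl, ?_⟩
      intro x s'' t'' h1 h2
      simp only [List.cons.injEq] at h1 h2
      exact hab (h1.1.trans h2.1.symm)

open TreeVertex

namespace IsAdapted

variable {Z C : Type*} [MetricSpace Z] {r : ℝ} {X : HypApprox Z r} {𝒰 : ℕ → C → Set (Set Z)}
  {F : Type*} {c : C}

/-- All levels above `k₀` are therefore nonnegative, and the truncation in the argument of
`morseThue` is harmless. -/
theorem neg_one_le_k₀ (h : IsAdapted X 𝒰) : -1 ≤ X.k₀ := by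
  refine X.isGreatest_k₀.2 ?_
  have h1 := (lt_min_iff.1 h.r_lt).2
  have hr := X.r_pos
  change Metric.diam (univ : Set Z) < r ^ (-1 : ℤ)
  rw [zpow_neg_one]
  rw [one_div] at h1
  have hD : 0 < (Metric.diam (univ : Set Z))⁻¹ := hr.trans h1
  exact lt_inv_of_lt_inv₀ hr h1

theorem index_add_le_of_chain (h : IsAdapted X 𝒰) (U : TreeVertex 𝒰 c) {a b : ℕ} (hab : a ≤ b)
    (hb : b < (h.chain U).length) :
    (h.chain U)[a].index + (b - a) ≤ (h.chain U)[b].index := by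
  induction b, hab using Nat.le_induction with
  | base => simp
  | succ b hab ih =>
    have h1 := ih (by omega)
    have h2 := List.pairwise_iff_getElem.1 (h.chain_sorted U) b (b + 1) (by omega) hb (by omega)
    omega

/-- If two close points lie in vertices with the same color sets of level `k`, then the points are
even closer. -/
theorem dist_le_of_colorSet_eq (h : IsAdapted X 𝒰) {μ : X.Vertex → F} (hμ : X.IsProperColoring μ)
    {W W' : TreeVertex 𝒰 c} {x x' : Z} (hx : x ∈ W.carrier) (hx' : x' ∈ W'.carrier) (k : ℤ)
    (hk : X.k₀ < k) (hkW' : k ≤ W'.level X.k₀)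
    (hc : h.colorSet μ W k hk.le = h.colorSet μ W' k hk.le)
    (hd : dist x x' ≤ 5 / 3 * r ^ (k - 1)) : dist x x' ≤ 5 / 3 * r ^ k := by
  have hW'0 : W'.index ≠ 0 := fun h0 => by
    rw [level_of_eq h0] at hkW'
    omega
  rw [level_of_ne hW'0] at hkW'
  have hdiam : ∀ y ∈ W'.carrier, dist y x' < r ^ k := fun y hy => by
    have h1 := h.dist_lt_of_mem hW'0 hy hx'
    have h2 := X.zpow_anti hkW'
    rw [zpow_natCast] at h2
    linarith
  obtain ⟨w, hw, hxw⟩ := X.exists_dist_lt x (k + 1) (by omega)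
  have hpos := zpow_pos X.r_pos (k + 1)
  have h6 := X.zpow_succ_le k
  have h6' := X.zpow_succ_le (k - 1)
  rw [sub_add_cancel] at h6'
  have hwc : μ w ∈ (h.colorSet μ W k hk.le).1 := by
    refine ⟨w, hw, ⟨x, ?_, hx⟩, rfl⟩
    rw [HypApprox.Vertex.ball, Metric.mem_ball, hw]
    linarith
  rw [hc] at hwc
  obtain ⟨w', hw', ⟨y, hyw', hy⟩, hμw⟩ := hwc
  rw [HypApprox.Vertex.ball, Metric.mem_ball, hw'] at hyw'
  have hyx := hdiam y hy
  -- The distance is at most `3 * r ^ (k + 1) + r ^ k + 5/3 * r ^ (k - 1)`, which is less than `2 *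
  -- r ^ (k - 1)`, the range in which `μ` distinguishes vertices of level `k + 1`.
  have hww : w = w' := by
    by_contra hne
    refine hμ w w' hne (hw.trans hw'.symm) ?_ hμw.symm
    rw [hw, show k + 1 - 2 = k - 1 by ring]
    have t1 := dist_triangle4 w.point x x' w'.point
    have t2 := dist_triangle x' y w'.point
    rw [dist_comm w.point x] at t1
    rw [dist_comm x' y] at t2
    linarith
  subst hww
  have t1 := dist_triangle4 x w.point y x'
  rw [dist_comm w.point y] at t1
  linarith

/-- Equal letters of the levels in `(k₁, j]` keep the points together. -/
theorem dist_le_of_letters_eq (h : IsAdapted X 𝒰) {μ : X.Vertex → F} (hμ : X.IsProperColoring μ)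
    {Y Y' : TreeVertex 𝒰 c} {x x' : Z} (hx : x ∈ Y.carrier) (hx' : x' ∈ Y'.carrier)
    (hlev : Y.level X.k₀ = Y'.level X.k₀) (k₁ : ℤ) (hk₁ : X.k₀ ≤ k₁) (hk₁Y : k₁ ≤ Y.level X.k₀)
    (hlet : ∀ k, k₁ < k → k ≤ Y.level X.k₀ →
      (flat (h.sentence μ Y))[(k - X.k₀ - 1).toNat]? =
        (flat (h.sentence μ Y'))[(k - X.k₀ - 1).toNat]?)
    (hd : dist x x' ≤ 5 / 3 * r ^ k₁) : dist x x' ≤ 5 / 3 * r ^ (Y.level X.k₀) := by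
  have key : ∀ k, k₁ ≤ k → k ≤ Y.level X.k₀ → dist x x' ≤ 5 / 3 * r ^ k := by
    intro k hk
    induction k, hk using Int.leInduction with
    | base => exact fun _ => hd
    | succ k hk ih =>
      intro hkY
      obtain ⟨W, hW, hkW, eW⟩ := h.exists_letter μ Y (k + 1) (by omega) hkY
      obtain ⟨W', hW', hkW', eW'⟩ := h.exists_letter μ Y' (k + 1) (by omega) (hlev ▸ hkY)
      have := hlet (k + 1) (by omega) hkY
      rw [eW, eW'] at this
      simp only [Option.some.injEq, Prod.mk.injEq] at this
      exact h.dist_le_of_colorSet_eq hμ (hW.subset hx) (hW'.subset hx') (k + 1) (by omega) hkW'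
        this.1 (by rw [add_sub_cancel_right]; exact ih (by omega))
  exact key _ hk₁Y le_rfl

/-- Vertices of the path of `v` with a successor of low level are also on the path of a close
vertex. -/
theorem mem_chain_of_close (h : IsAdapted X 𝒰) {v v' : X.Vertex} {l : ℤ} (hlv' : l ≤ v'.level)
    (hd : dist v.point v'.point ≤ 5 / 3 * r ^ l) {W Y : TreeVertex 𝒰 c}
    (hW : W ∈ h.chain (h.colorMap c v)) (hY : Y ∈ h.chain (h.colorMap c v))
    (hWY : W.index < Y.index) (hYl : (Y.index : ℤ) ≤ l - 2) : W ∈ h.chain (h.colorMap c v') := by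
  rw [mem_chain_colorMap] at hW hY ⊢
  refine ⟨hW.1, ?_, by omega⟩
  have hk := h.k₀_nonpos
  have hx := hW.2.1 v.point_mem_ball
  have hxY := hY.2.1 v.point_mem_ball
  have hanc : IsAncestor W Y := by
    rcases h.above_of_mem hx hxY hWY.le with rfl | h1
    · omega
    · exact h1
  -- The ball of `w` meets `Y`, so it lies in `B(Y)` and in `W`. It contains `B(v')` because `Y` has
  -- level at most `l - 2`.
  obtain ⟨w, hw, hvw⟩ := X.exists_dist_lt v.point ((Y.index : ℤ) + 1) (by omega)
  have h6 := X.zpow_succ_le ((Y.index : ℤ) + 1)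
  have hl1 := X.zpow_anti (show (Y.index : ℤ) + 1 + 1 ≤ l by omega)
  have hl2 := X.zpow_anti hlv'
  have hpos := zpow_pos X.r_pos ((Y.index : ℤ) + 1)
  refine Subset.trans ?_ ((ball_subset_hull hw ⟨v.point, ?_, hxY⟩).trans (h.hull_subset hanc))
  · refine Metric.ball_subset_ball' ?_
    rw [hw]
    have := dist_triangle v'.point v.point w.point
    rw [dist_comm v'.point v.point] at this
    linarith
  · rw [HypApprox.Vertex.ball, Metric.mem_ball, hw]
    linarith

/-- If the common part of the paths of `v` and `v'` is followed by two more vertices, then the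
levels of the second ones are large. -/
theorem le_index_of_heads_ne (h : IsAdapted X 𝒰) {v v' : X.Vertex} {l : ℤ} (hlv' : l ≤ v'.level)
    (hd : dist v.point v'.point ≤ 5 / 3 * r ^ l) {P S S' : List (TreeVertex 𝒰 c)}
    (hS : h.chain (h.colorMap c v) = P ++ S) (hS' : h.chain (h.colorMap c v') = P ++ S')
    (hne : ∀ a s s', S = a :: s → S' = a :: s' → False)
    (hn : P.length + 1 < (h.chain (h.colorMap c v)).length) :
    l - 1 ≤ ((h.chain (h.colorMap c v))[P.length + 1].index : ℤ) := by
  by_contra! hcon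
  -- The first vertex after `P` would have a successor of low level, hence lie on both paths,
  -- against the choice of `P`.
  have hlt := List.pairwise_iff_getElem.1 (h.chain_sorted (h.colorMap c v)) P.length
    (P.length + 1) (by omega) hn (by omega)
  have hmem : (h.chain (h.colorMap c v))[P.length] ∈ h.chain (h.colorMap c v') :=
    h.mem_chain_of_close hlv' hd (List.getElem_mem _) (List.getElem_mem hn) hlt (by omega)
  have hpre := h.chain_prefix (h.mem_chain.1 hmem).2
  rw [h.chain_getElem, hS', hS] at hpre
  rcases S with _ | ⟨a, s⟩
  · rw [hS] at hn
    simp at hn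
  · rw [List.take_append, List.take_of_length_le (by omega)] at hpre
    simp only [Nat.add_sub_cancel_left, List.take_succ_cons, List.take_zero,
      List.prefix_append_right_inj] at hpre
    obtain ⟨t, ht⟩ := hpre
    exact hne a s t rfl ht.symm

/-- Reading the diaries of two vertices of a colored tree which are equal: if the last words of the
sentence of `Y` are not too long on the average, then many of the last letters are known. -/
theorem flat_sentence_eq_or (h : IsAdapted X 𝒰) (μ : X.Vertex → F) {κ : ℕ}
    {Y Y' : TreeVertex 𝒰 c} {P S S' : List (TreeVertex 𝒰 c)} (hY : h.chain Y = P ++ S)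
    (hY' : h.chain Y' = P ++ S') (hl : S.length = S'.length)
    (hd : diary κ (h.sentence μ Y) = diary κ (h.sentence μ Y'))
    (hb : ∀ W ∈ h.chain Y, P.length + 2 ≤ (h.chain W).length →
      Y.level X.k₀ - W.level X.k₀ ≤
        ((κ : ℤ) - 1) * ((h.chain Y).length - (h.chain W).length)) :
    flat (h.sentence μ Y) = flat (h.sentence μ Y') ∨
      ∃ R : ℕ, (κ - 1) * (S.length - 1) ≤ R ∧
        R ≤ (flat (h.sentence μ Y)).length ∧ R ≤ (flat (h.sentence μ Y')).length ∧
        (flat (h.sentence μ Y)).reverse.take R = (flat (h.sentence μ Y')).reverse.take R := by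
  have hs : h.sentence μ Y = P.map (h.lastWord μ) ++ S.map (h.lastWord μ) := by
    rw [h.sentence_eq_map, hY, List.map_append]
  have hs' : h.sentence μ Y' = P.map (h.lastWord μ) ++ S'.map (h.lastWord μ) := by
    rw [h.sentence_eq_map, hY', List.map_append]
  have hm := h.stopsMarked_sentence μ Y
  have hm' := h.stopsMarked_sentence μ Y'
  -- The weight is the level difference plus one stop sign per word, so an average of `κ - 1` levels
  -- per word is an average weight of `κ`.
  have hballot : ∀ d, 2 ≤ d → weight ((S.map (h.lastWord μ)).drop d) ≤
      κ * ((S.map (h.lastWord μ)).drop d).length := by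
    intro d hd2
    by_cases hdS : S.length ≤ d
    · rw [List.drop_of_length_le (by simpa using hdS)]
      simp [weight]
    have hlen : (h.chain Y).length = P.length + S.length := by rw [hY, List.length_append]
    have hn : P.length + d - 1 < (h.chain Y).length := by omega
    obtain ⟨W, hW⟩ : ∃ W, W = (h.chain Y)[P.length + d - 1] := ⟨_, rfl⟩
    have hWm : W ∈ h.chain Y := hW ▸ List.getElem_mem _
    have hWchain : h.chain W = P ++ S.take d := by
      rw [hW, h.chain_getElem, show P.length + d - 1 + 1 = P.length + d by omega, hY,
        List.take_append, List.take_of_length_le (by omega), Nat.add_sub_cancel_left]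
    have hsplit : h.sentence μ Y = h.sentence μ W ++ (S.map (h.lastWord μ)).drop d := by
      rw [hs, h.sentence_eq_map μ W, hWchain, List.map_append, List.append_assoc, List.map_take,
        List.take_append_drop]
    have hWlen : (h.chain W).length = P.length + d := by
      rw [hWchain, List.length_append, List.length_take]
      omega
    have hw1 := h.weight_sentence μ Y
    have hw2 := h.weight_sentence μ W
    have hwadd : weight (h.sentence μ Y) =
        weight (h.sentence μ W) + weight ((S.map (h.lastWord μ)).drop d) := by
      conv_lhs => rw [hsplit]
      simp [weight]
    have hg := hb W hWm (by omega)
    have hdl : ((S.map (h.lastWord μ)).drop d).length = S.length - d := by simp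
    rw [hdl]
    rw [hlen] at hw1 hg
    rw [hWlen] at hw2 hg
    rw [hwadd] at hw1
    zify [show d ≤ S.length by omega]
    push_cast at hw1 hw2 hg ⊢
    linarith
  have := flat_eq_or_take_flat_eq (fun x : Letter F => x.1.isNone = true) (κ := κ)
    (ρ := P.map (h.lastWord μ)) (σ := S.map (h.lastWord μ)) (σ' := S'.map (h.lastWord μ))
    (by simpa using hl) (by rwa [← hs]) (by rwa [← hs']) (by rwa [← hs, ← hs']) hballot
  rw [← hs, ← hs', List.length_map] at this
  exact this

/-- If many of the last letters of two sentences coincide, then so do the levels, and the vertices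
are close to each other. -/
theorem dist_le_of_read (h : IsAdapted X 𝒰) (hbounded : Bornology.IsBounded (univ : Set Z))
    {μ : X.Vertex → F} (hμ : X.IsProperColoring μ) {Y Y' : TreeVertex 𝒰 c} (hY0 : Y.index ≠ 0)
    (hY0' : Y'.index ≠ 0) {x x' : Z} (hx : x ∈ Y.carrier) (hx' : x' ∈ Y'.carrier) {l : ℤ} {R₀ : ℕ}
    (hd : dist x x' ≤ 5 / 3 * r ^ l) (h1 : 2 * ((Y.index : ℤ) - Y'.index) ≤ R₀)
    (h2 : 2 * ((Y'.index : ℤ) - Y.index) ≤ R₀) (h3 : (Y.index : ℤ) - l ≤ R₀)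
    (hread : flat (h.sentence μ Y) = flat (h.sentence μ Y') ∨
      ∃ R : ℕ, R₀ ≤ R ∧
        R ≤ (flat (h.sentence μ Y)).length ∧ R ≤ (flat (h.sentence μ Y')).length ∧
        (flat (h.sentence μ Y)).reverse.take R = (flat (h.sentence μ Y')).reverse.take R) :
    Y.index = Y'.index ∧ dist x x' ≤ 5 / 3 * r ^ (Y.index : ℤ) := by
  have hk0 := h.k₀_nonpos
  have hlevY : Y.level X.k₀ = Y.index := level_of_ne hY0
  have hlevY' : Y'.level X.k₀ = Y'.index := level_of_ne hY0'
  have hfl := h.length_flat_sentence μ Y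
  have hfl' := h.length_flat_sentence μ Y'
  rw [hlevY] at hfl
  rw [hlevY'] at hfl'
  rcases hread with heq | ⟨R, hR, hR1, hR2, hRe⟩
  · have hidx : Y.index = Y'.index := by
      rw [heq] at hfl
      omega
    refine ⟨hidx, ?_⟩
    rw [← hlevY]
    refine h.dist_le_of_letters_eq hμ hx hx' (by omega) X.k₀ le_rfl (by omega)
      (fun k _ _ => by rw [heq]) ?_
    have h1 := Metric.dist_le_diam_of_mem hbounded (mem_univ x) (mem_univ x')
    have h2 : Metric.diam (univ : Set Z) < r ^ X.k₀ := X.isGreatest_k₀.1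
    have := zpow_pos X.r_pos X.k₀
    linarith
  · have hletter : ∀ x < R, (flat (h.sentence μ Y))[(flat (h.sentence μ Y)).length - 1 - x]? =
        (flat (h.sentence μ Y'))[(flat (h.sentence μ Y')).length - 1 - x]? := by
      intro x hx
      have := congrArg (fun l => l[x]?) hRe
      simp only [List.getElem?_take_of_lt hx] at this
      rwa [List.getElem?_reverse (by omega), List.getElem?_reverse (by omega)] at this
    -- The last `R` decorations are equal factors of the Morse-Thue sequence ending at the two
    -- indices, whose difference is at most `R / 2`.
    have hidx : Y.index = Y'.index := by
      refine eq_of_morseThue_eq (R := R) (by have := h.neg_one_le_k₀; omega)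
        (by have := h.neg_one_le_k₀; omega) (by omega) (by omega) ?_
      intro x hx
      obtain ⟨W, -, -, e1⟩ := h.exists_letter μ Y (Y.index - x) (by omega) (by omega)
      obtain ⟨W', -, -, e2⟩ := h.exists_letter μ Y' (Y'.index - x) (by omega) (by omega)
      have := hletter x hx
      rw [show (flat (h.sentence μ Y)).length - 1 - x = ((Y.index : ℤ) - x - X.k₀ - 1).toNat by
          omega,
        show (flat (h.sentence μ Y')).length - 1 - x = ((Y'.index : ℤ) - x - X.k₀ - 1).toNat by
          omega, e1, e2] at this
      simp only [Option.some.injEq, Prod.mk.injEq] at this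
      have h2 := this.2
      rwa [show ((Y.index : ℤ) - x).toNat = Y.index - x by omega,
        show ((Y'.index : ℤ) - x).toNat = Y'.index - x by omega] at h2
    refine ⟨hidx, ?_⟩
    rw [← hlevY]
    -- The known letters reach down to level `Y.index - R ≤ l`, where the distance is already under
    -- control.
    refine h.dist_le_of_letters_eq hμ hx hx' (by omega) (Y.index - R) (by omega) (by omega) ?_ ?_
    · intro k hk1 hk2
      have := hletter (Y.index - k).toNat (by omega)
      rwa [show (flat (h.sentence μ Y)).length - 1 - ((Y.index : ℤ) - k).toNat =
          (k - X.k₀ - 1).toNat by omega,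
        show (flat (h.sentence μ Y')).length - 1 - ((Y.index : ℤ) - k).toNat =
          (k - X.k₀ - 1).toNat by omega] at this
    · have h1 := X.zpow_anti (show (Y.index : ℤ) - R ≤ l by omega)
      linarith

theorem diary_sentence_eq_take (h : IsAdapted X 𝒰) (μ : X.Vertex → F) {κ : ℕ}
    {U T : TreeVertex 𝒰 c} {D : List (Page κ (Letter F))} (hT : Above T U)
    (hD : D <+: diary κ (h.sentence μ U)) (hlen : (h.chain T).length ≤ D.length) :
    diary κ (h.sentence μ T) = D.take (h.chain T).length := by
  have h1 : diary κ (h.sentence μ T) <+: diary κ (h.sentence μ U) := by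
    refine diary_prefix ?_
    rw [h.sentence_eq_map, h.sentence_eq_map]
    exact (h.chain_prefix hT).map _
  have h2 : (diary κ (h.sentence μ T)).length = (h.chain T).length := by
    rw [length_diary, h.sentence_eq_map, List.length_map]
  rw [← h2] at hlen ⊢
  exact List.prefix_iff_eq_take.1 (List.prefix_of_prefix_length_le h1 hD hlen)

/-- The estimate in one color: if the diaries of `v` and `v'` have `p` common pages, then `p` is not
much larger than the number `q` of the common vertices of the two paths. -/
theorem exists_common_bound (h : IsAdapted X 𝒰) (hbounded : Bornology.IsBounded (univ : Set Z))
    {μ : X.Vertex → F} (hμ : X.IsProperColoring μ)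
    {κ : ℕ} (hκ : 2 ≤ κ) {v v' : X.Vertex} {l : ℤ} (hlv : l ≤ v.level)
    (hlv' : l ≤ v'.level) (hvv' : v'.level ≤ v.level)
    (hd : dist v.point v'.point ≤ 5 / 3 * r ^ l)
    (hmax : ∀ k, k ≤ v.level → k ≤ v'.level → dist v.point v'.point ≤ 5 / 3 * r ^ k → k ≤ l)
    (c : C) {D : List (Page κ (Letter F))}
    (hD : D <+: diary κ (h.sentence μ (h.colorMap c v)))
    (hD' : D <+: diary κ (h.sentence μ (h.colorMap c v'))) :
    ∃ q : ℕ, q ≤ (h.chain (h.colorMap c v)).length ∧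
      (∀ W ∈ (h.chain (h.colorMap c v)).take q, (W.index : ℤ) ≤ l) ∧
      ((κ : ℤ) - 1) * (D.length - q - 1) ≤ 3 * (v.level - l) + 3 * ((κ : ℤ) - 1) := by
  obtain ⟨P, S, S', hS, hS', hne⟩ := exists_common_prefix_heads_ne (h.chain (h.colorMap c v))
    (h.chain (h.colorMap c v'))
  have hm := fun W => h.mem_chain_colorMap (c := c) v W
  have hm' := fun W => h.mem_chain_colorMap (c := c) v' W
  have hlow := h.le_index_of_heads_ne hlv' hd hS hS' hne
  have hlow' := h.le_index_of_heads_ne hlv (by rwa [dist_comm]) hS' hS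
    (fun a s s' h1 h2 => hne a s' s h2 h1)
  generalize h.colorMap c v = U at *
  generalize h.colorMap c v' = U' at *
  refine ⟨P.length, by simp [hS], ?_, ?_⟩
  · intro W hW
    rw [hS, List.take_left] at hW
    have h1 := (hm W).1 (by rw [hS]; simp [hW])
    have h2 := (hm' W).1 (by rw [hS']; simp [hW])
    refine hmax _ (by omega) (by omega) ?_
    -- A shared vertex contains both points, so its diameter bounds their distance.
    have h3 := h.dist_lt_of_mem h1.1 (h1.2.1 v.point_mem_ball) (h2.2.1 v'.point_mem_ball)
    rw [zpow_natCast]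
    have := pow_pos X.r_pos W.index
    linarith
  by_contra! hbig
  have hDl := hD.length_le
  have hDl' := hD'.length_le
  rw [length_diary, h.sentence_eq_map, List.length_map] at hDl hDl'
  have hκ1 : (0 : ℤ) < κ - 1 := by omega
  have hpq : P.length + 4 < D.length := by
    by_contra! hcon
    have : (D.length : ℤ) - P.length - 1 ≤ 3 := by omega
    have := mul_le_mul_of_nonneg_left this hκ1.le
    linarith
  -- the page to read from
  obtain ⟨i, hi, himax⟩ := Finset.exists_max_image (Finset.Icc (P.length + 2) D.length)
    (fun t => ((κ : ℤ) - 1) * t - ((h.chain U).getD (t - 1) (h.root c)).index)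
    ⟨D.length, by simp; omega⟩
  rw [Finset.mem_Icc] at hi
  have hgetD : ∀ t, ∀ ht : t < (h.chain U).length,
      (h.chain U).getD t (h.root c) = (h.chain U)[t] := fun t ht => by
    rw [List.getD_eq_getElem?_getD, List.getElem?_eq_getElem ht, Option.getD_some]
  obtain ⟨Y, hY⟩ : ∃ Y, Y = (h.chain U)[i - 1] := ⟨_, rfl⟩
  obtain ⟨Y', hY'⟩ : ∃ Y', Y' = (h.chain U')[i - 1] := ⟨_, rfl⟩
  -- Maximality at `i` is precisely the bound on level gaps required by `flat_sentence_eq_or`. The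
  -- default value in `getD` is never read, since all positions lie on the path.
  have himax' : ∀ n, ∀ hn : P.length + 2 ≤ n ∧ n ≤ D.length,
      ((κ : ℤ) - 1) * n - ((h.chain U)[n - 1].index : ℤ) ≤
        ((κ : ℤ) - 1) * i - (Y.index : ℤ) := by
    intro n hn
    have := himax n (Finset.mem_Icc.2 hn)
    rwa [hgetD _ (by omega), hgetD _ (by omega), ← hY] at this
  clear himax hgetD
  have hYlow := h.index_add_le_of_chain U (a := P.length + 1) (b := i - 1) (by omega) (by omega)
  have hYlow' := h.index_add_le_of_chain U' (a := P.length + 1) (b := i - 1) (by omega) (by omega)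
  have hYm : (h.chain U)[i - 1] ∈ h.chain U := List.getElem_mem _
  have hYm' : (h.chain U')[i - 1] ∈ h.chain U' := List.getElem_mem _
  have hYchain := h.chain_getElem U (i - 1) (by omega)
  have hYchain' := h.chain_getElem U' (i - 1) (by omega)
  have hlow := hlow (by omega)
  have hlow' := hlow' (by omega)
  rw [← hY] at hYlow hYm hYchain
  rw [← hY'] at hYlow' hYm' hYchain'
  rw [show i - 1 + 1 = i by omega, hS, List.take_append, List.take_of_length_le (by omega)]
    at hYchain
  rw [show i - 1 + 1 = i by omega, hS', List.take_append, List.take_of_length_le (by omega)]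
    at hYchain'
  have hSl : P.length + S.length = (h.chain U).length := by rw [hS, List.length_append]
  have hSl' : P.length + S'.length = (h.chain U').length := by rw [hS', List.length_append]
  have hY1 := (hm Y).1 hYm
  have hY1' := (hm' Y').1 hYm'
  -- Replacing `D.length` by `i` costs at most `v.level - l`, because the levels involved lie
  -- between `l - 1` and `v.level - 1`. This turns the factor `3` into `2`.
  have hib : 2 * (v.level - l) + 3 * ((κ : ℤ) - 1) < ((κ : ℤ) - 1) * (i - P.length - 1) := by
    have h1 := himax' D.length ⟨by omega, le_rfl⟩
    have h3 := ((hm (h.chain U)[D.length - 1]).1 (List.getElem_mem _)).2.2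
    have h4 : ((h.chain U)[D.length - 1].index : ℤ) - Y.index ≤ v.level - l := by omega
    linarith
  have hi4 : P.length + 4 < i := by
    by_contra! hcon
    have : (i : ℤ) - P.length - 1 ≤ 3 := by omega
    have := mul_le_mul_of_nonneg_left this hκ1.le
    linarith
  have hYlen : (h.chain Y).length = i := by
    rw [hYchain, List.length_append, List.length_take]
    omega
  have hYlen' : (h.chain Y').length = i := by
    rw [hYchain', List.length_append, List.length_take]
    omega
  have hread := h.flat_sentence_eq_or μ hYchain hYchain'
    (by rw [List.length_take, List.length_take]; omega)
    (by rw [h.diary_sentence_eq_take μ (h.mem_chain.1 hYm).2 hD (by omega),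
      h.diary_sentence_eq_take μ (h.mem_chain.1 hYm').2 hD' (by omega), hYlen, hYlen'])
    (by
      intro W hW hWlen
      have hW0 := (h.mem_chain.1 hW).1
      have hWU := (h.mem_chain.1 hW).2.trans (h.mem_chain.1 hYm).2
      have hWi := (h.chain_prefix (h.mem_chain.1 hW).2).length_le
      have hWU' : (h.chain U)[(h.chain W).length - 1]'(by omega) = W := by
        have h1 := h.chain_prefix hWU
        have h2 := h1.getElem (i := (h.chain W).length - 1) (by omega)
        rw [← h2]
        have h3 : ∀ (L : List (TreeVertex 𝒰 c)) (hL : L.length - 1 < L.length),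
            L = h.chain (h.parent W hW0) ++ [W] → L[L.length - 1] = W := by
          rintro L hL rfl
          simp
        exact h3 _ _ (h.chain_of_ne hW0)
      have := himax' (h.chain W).length ⟨hWlen, by omega⟩
      rw [hWU'] at this
      rw [level_of_ne hY1.1, level_of_ne hW0, hYlen]
      linarith)
  -- Both indices lie between `l` and `v.level - 1`, so this bounds twice their difference and also
  -- the number of letters needed to reach down to level `l`.
  have hR0 : 2 * (v.level - l) ≤ (((κ - 1) * ((S.take (i - P.length)).length - 1) : ℕ) : ℤ) := by
    rw [List.length_take, min_eq_left (by omega)]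
    push_cast [show 1 ≤ κ by omega, show 1 ≤ i - P.length by omega, show P.length ≤ i by omega]
    linarith
  obtain ⟨h1, h2⟩ := h.dist_le_of_read hbounded hμ hY1.1 hY1'.1 (hY1.2.1 v.point_mem_ball)
    (hY1'.2.1 v'.point_mem_ball) hd (by omega) (by omega) (by omega) hread
  -- The index of `Y` exceeds `l`: the levels start at `l - 1` at position `P.length + 1` and
  -- increase strictly up to position `i - 1`, with `i > P.length + 4`.
  have := hmax _ (by omega) (by omega) h2
  omega

/-- The vertices of the paths of `v` in all colors have all levels below the level of `v`. -/
theorem exists_mem_chain (h : IsAdapted X 𝒰) (v : X.Vertex) (j : ℕ) (hj : j ≠ 0)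
    (hjv : (j : ℤ) ≤ v.level - 1) :
    ∃ c, ∃ W ∈ h.chain (h.colorMap c v), W.index = j := by
  have hk := h.k₀_nonpos
  obtain ⟨w, hw, hb, -⟩ := HypApprox.exists_walk_lower v ((j : ℤ) + 1) (by omega) (by omega)
  obtain ⟨c, U, hU, hwU⟩ := h.ball_subset j w hw
  exact ⟨c, ⟨(j, U), hU⟩, (h.mem_chain_colorMap v _).2 ⟨hj, hb.trans hwU, hjv⟩, rfl⟩

/-- The lower bound for the distance of the diaries. -/
theorem level_sub_le [Fintype C] (h : IsAdapted X 𝒰)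
    (hbounded : Bornology.IsBounded (univ : Set Z))
    {μ : X.Vertex → F} (hμ : X.IsProperColoring μ)
    {κ : ℕ} (hκ : 15 * Fintype.card C + 1 ≤ κ) {v v' : X.Vertex} {l : ℤ} (hl : X.k₀ ≤ l)
    (hlv : l ≤ v.level) (hlv' : l ≤ v'.level) (hvv' : v'.level ≤ v.level)
    (hd : dist v.point v'.point ≤ 5 / 3 * r ^ l)
    (hmax : ∀ k, k ≤ v.level → k ≤ v'.level → dist v.point v'.point ≤ 5 / 3 * r ^ k → k ≤ l) :
    4 * (v.level - l) ≤ 5 * (∑ c, ((wordTree _).dist (diary κ (h.sentence μ (h.colorMap c v)))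
      (diary κ (h.sentence μ (h.colorMap c v'))) : ℤ)) + 10 + 20 * Fintype.card C := by
  classical
  have hk := h.k₀_nonpos
  have hcard : 1 ≤ Fintype.card C := by
    obtain ⟨c, -⟩ := mem_iUnion.1 ((h.isCover 0).cover ▸ mem_univ v.point)
    exact Fintype.card_pos_iff.2 ⟨c⟩
  choose D hD hD' hDlen using fun c =>
    exists_common_prefix (diary κ (h.sentence μ (h.colorMap c v)))
      (diary κ (h.sentence μ (h.colorMap c v')))
  choose q hq1 hq2 hq3 using fun c =>
    h.exists_common_bound hbounded hμ (by omega : 2 ≤ κ) hlv hlv' hvv' hd hmax c (hD c) (hD' c)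
  set dist : C → ℕ := fun c => (wordTree _).dist (diary κ (h.sentence μ (h.colorMap c v)))
      (diary κ (h.sentence μ (h.colorMap c v'))) with hdist
  have hD1 : ∀ c, ((h.chain (h.colorMap c v)).length : ℤ) ≤ dist c + (D c).length := by
    intro c
    have h1 := hDlen c
    have h2 := (hD' c).length_le
    have h3 : (diary κ (h.sentence μ (h.colorMap c v))).length =
        (h.chain (h.colorMap c v)).length := by
      rw [length_diary, h.sentence_eq_map, List.length_map]
    change _ ≤ dist c + _ at h1
    omega
  -- all levels above `l` are met after the common parts
  have hcount : v.level - l - 2 ≤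
      ∑ c, (((h.chain (h.colorMap c v)).length : ℤ) - q c) := by
    have hsub : Finset.Ioc l.toNat (v.level - 1).toNat ⊆ Finset.univ.biUnion fun c =>
        (((h.chain (h.colorMap c v)).drop (q c)).map TreeVertex.index).toFinset := by
      intro j hj
      rw [Finset.mem_Ioc] at hj
      obtain ⟨c, W, hW, rfl⟩ := h.exists_mem_chain v j (by omega) (by omega)
      refine Finset.mem_biUnion.2 ⟨c, Finset.mem_univ _, ?_⟩
      rw [List.mem_toFinset]
      refine List.mem_map_of_mem ?_
      rw [← List.take_append_drop (q c) (h.chain (h.colorMap c v)), List.mem_append] at hW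
      rcases hW with hW | hW
      · have := hq2 c W hW
        omega
      · exact hW
    have h1 := (Finset.card_le_card hsub).trans Finset.card_biUnion_le
    have h2 : ∑ c, (((h.chain (h.colorMap c v)).drop (q c)).map TreeVertex.index).toFinset.card ≤
        ∑ c, ((h.chain (h.colorMap c v)).length - q c) := by
      refine Finset.sum_le_sum fun c _ => (List.toFinset_card_le _).trans ?_
      simp
    have h3 : ((∑ c, ((h.chain (h.colorMap c v)).length - q c) : ℕ) : ℤ) =
        ∑ c, (((h.chain (h.colorMap c v)).length : ℤ) - q c) := by
      push_cast
      exact Finset.sum_congr rfl fun c _ => Nat.cast_sub (hq1 c)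
    rw [Nat.card_Ioc] at h1
    -- If `l = -1`, then `l.toNat` is `0` and one level is lost; hence the `2` on the left side.
    have := h.neg_one_le_k₀
    omega
  have hκ1 : (15 : ℤ) * Fintype.card C ≤ κ - 1 := by omega
  set N := v.level - l with hN
  set n : ℤ := (Fintype.card C : ℤ) with hn
  have hN0 : 0 ≤ N := by omega
  have hn1 : 1 ≤ n := by omega
  have hsum1 : N - 2 - n ≤ ∑ c, (dist c : ℤ) + ∑ c, (((D c).length : ℤ) - q c - 1) := by
    have h1 : ∑ c, (((h.chain (h.colorMap c v)).length : ℤ) - q c) ≤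
        ∑ c, ((dist c : ℤ) + (((D c).length : ℤ) - q c - 1) + 1) :=
      Finset.sum_le_sum fun c _ => by have := hD1 c; omega
    rw [Finset.sum_add_distrib, Finset.sum_add_distrib] at h1
    simp only [Finset.sum_const, Finset.card_univ, nsmul_eq_mul, mul_one] at h1
    omega
  have hsum2 : ((κ : ℤ) - 1) * ∑ c, (((D c).length : ℤ) - q c - 1) ≤
      n * (3 * N + 3 * ((κ : ℤ) - 1)) := by
    rw [Finset.mul_sum]
    refine (Finset.sum_le_sum fun c _ => hq3 c).trans ?_
    simp [hn]
  set A := ∑ c, (((D c).length : ℤ) - q c - 1)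
  -- Dividing by `κ - 1 ≥ 15 * n` turns `3 * n * N` into `N / 5`, which the left side of `hsum1` can
  -- absorb.
  have hA : 5 * A ≤ N + 15 * n := by
    have hpos : (0 : ℤ) < κ - 1 := by omega
    refine le_of_mul_le_mul_left ?_ hpos
    nlinarith
  linarith

end IsAdapted

/-! ### The branch level of two vertices and the final estimate -/

theorem exists_branch_level {Z : Type*} [MetricSpace Z] {r : ℝ} {X : HypApprox Z r}
    (hbounded : Bornology.IsBounded (univ : Set Z)) (v v' : X.Vertex) :
    ∃ l, X.k₀ ≤ l ∧ l ≤ v.level ∧ l ≤ v'.level ∧ dist v.point v'.point ≤ 5 / 3 * r ^ l ∧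
      ∀ k, k ≤ v.level → k ≤ v'.level → dist v.point v'.point ≤ 5 / 3 * r ^ k → k ≤ l := by
  have h0 : dist v.point v'.point ≤ 5 / 3 * r ^ X.k₀ := by
    have h1 := Metric.dist_le_diam_of_mem hbounded (mem_univ v.point) (mem_univ v'.point)
    have h2 : Metric.diam (univ : Set Z) < r ^ X.k₀ := X.isGreatest_k₀.1
    have := zpow_pos X.r_pos X.k₀
    linarith
  obtain ⟨l, ⟨h1, h2, h3⟩, h4⟩ := Int.exists_greatest_of_bdd
    (P := fun k => k ≤ v.level ∧ k ≤ v'.level ∧ dist v.point v'.point ≤ 5 / 3 * r ^ k)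
    ⟨v.level, fun _ h => h.1⟩ ⟨X.k₀, v.2.1, v'.2.1, h0⟩
  exact ⟨l, h4 _ ⟨v.2.1, v'.2.1, h0⟩, h1, h2, h3, fun k a b c => h4 k ⟨a, b, c⟩⟩

/-- The composition of the diary map with the map into the product of colored trees is
quasi-isometric. -/
theorem IsAdapted.isQuasiIsometric {Z C : Type*} [MetricSpace Z] [Nonempty Z] [Fintype C] {r : ℝ}
    {X : HypApprox Z r} {𝒰 : ℕ → C → Set (Set Z)} {F : Type*}
    (h : IsAdapted X 𝒰) (hbounded : Bornology.IsBounded (univ : Set Z))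
    {μ : X.Vertex → F} (hμ : X.IsProperColoring μ) {κ : ℕ} (hκ : 15 * Fintype.card C + 1 ≤ κ) :
    IsQuasiIsometric X.vdist prodDist (h.prodDiary μ κ ∘ h.prodMap) := by
  have hconn := HypApprox.graph_connected (X := X) hbounded
  have hprod : ∀ v v', prodDist ((h.prodDiary μ κ ∘ h.prodMap) v)
      ((h.prodDiary μ κ ∘ h.prodMap) v') =
      ((∑ c, ((wordTree _).dist (diary κ (h.sentence μ (h.colorMap c v)))
      (diary κ (h.sentence μ (h.colorMap c v'))) : ℤ) : ℤ) : ℝ) := by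
    intro v v'
    push_cast
    rfl
  -- The lower bound results from `2|vv'| ≤ 4 * (max - l) + 6`, where `max` is the larger level, and
  -- `level_sub_le`; the upper bound from at most four pages per edge and color.
  refine ⟨2 / 5, 4 * Fintype.card C + 1, 10 + 10 * Fintype.card C, by norm_num, by positivity,
    by positivity, fun v v' => ⟨?_, ?_⟩⟩
  · obtain ⟨l, h1, h2, h3, h4, h5⟩ := exists_branch_level hbounded v v'
    have hdist := HypApprox.dist_le_of_dist_point_le hbounded v v' l h1 h2 h3 h4
    have hmain : 4 * (max v.level v'.level - l) ≤
        5 * (∑ c, ((wordTree _).dist (diary κ (h.sentence μ (h.colorMap c v)))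
      (diary κ (h.sentence μ (h.colorMap c v'))) : ℤ)) + 10 + 20 * Fintype.card C := by
      rcases le_total v'.level v.level with hle | hle
      · rw [max_eq_left hle]
        exact h.level_sub_le hbounded hμ hκ h1 h2 h3 hle h4 h5
      · rw [max_eq_right hle]
        have := h.level_sub_le hbounded hμ hκ h1 h3 h2 hle (by rwa [dist_comm])
          (fun k a b c => h5 k b a (by rwa [dist_comm]))
        simpa only [SimpleGraph.dist_comm] using this
    rw [hprod, HypApprox.vdist]
    set T := ∑ c, ((wordTree _).dist (diary κ (h.sentence μ (h.colorMap c v)))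
      (diary κ (h.sentence μ (h.colorMap c v'))) : ℤ)
    have hfin : 2 * (X.graph.dist v v' : ℤ) ≤ 5 * T + 16 + 20 * Fintype.card C := by
      have := le_max_left v.level v'.level
      have := le_max_right v.level v'.level
      linarith
    have hfin' : 2 * (X.graph.dist v v' : ℝ) ≤ 5 * T + 16 + 20 * Fintype.card C := by
      exact_mod_cast hfin
    linarith
  · obtain ⟨p, hp⟩ := hconn.exists_walk_length_eq_dist v v'
    have h1 : (∑ c, ((wordTree _).dist (diary κ (h.sentence μ (h.colorMap c v)))
      (diary κ (h.sentence μ (h.colorMap c v'))) : ℤ)) ≤ ∑ _c : C, 4 * (X.graph.dist v v' : ℤ) := by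
      refine Finset.sum_le_sum fun c _ => ?_
      rw [← hp]
      exact_mod_cast h.diary_dist_le hbounded μ κ p c
    rw [Finset.sum_const, Finset.card_univ, nsmul_eq_mul] at h1
    rw [hprod, HypApprox.vdist]
    have h2 : (((∑ c, ((wordTree _).dist (diary κ (h.sentence μ (h.colorMap c v)))
      (diary κ (h.sentence μ (h.colorMap c v'))) : ℤ)) : ℤ) : ℝ) ≤
        Fintype.card C * (4 * (X.graph.dist v v' : ℝ)) := by
      exact_mod_cast h1
    refine h2.trans ?_
    have : (0 : ℝ) ≤ X.graph.dist v v' := by positivity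
    have : (0 : ℝ) ≤ Fintype.card C := by positivity
    nlinarith

end AliceDiary

theorem theorem8p2 {Z : Type*} [MetricSpace Z] [Nontrivial Z]
    (hbounded : Bornology.IsBounded (Set.univ : Set Z)) (hdoubling : IsDoubling Z)
    (n : ℕ) (hn : cdim Z = n) {C : Type*} [Fintype C] (hC : Fintype.card C = n + 1) :
    -- for every small parameter, all the data of the construction exist
    (∃ r₀ : ℝ, 0 < r₀ ∧ ∀ r : ℝ, 0 < r → r < r₀ →
      Nonempty (HypApprox Z r) ∧
      (∃ 𝒰 : ℕ → C → Set (Set Z), ∀ X : HypApprox Z r, IsAdapted X 𝒰) ∧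
      (∃ N : ℕ, ∀ X : HypApprox Z r, ∃ μ : X.Vertex → Fin N, X.IsProperColoring μ)) ∧
    -- for every choice of the data, the composition is quasi-isometric
    (∀ (r : ℝ) (X : HypApprox Z r) (𝒰 : ℕ → C → Set (Set Z)) (h : IsAdapted X 𝒰)
      (F : Type*) [Finite F] (μ : X.Vertex → F), X.IsProperColoring μ →
      ∀ κ : ℕ, 15 * Fintype.card C + 1 ≤ κ →
        X.graph.Connected ∧
        (wordTree (Page κ (Letter F))).IsTree ∧
        (∀ w, ((wordTree (Page κ (Letter F))).neighborSet w).Finite) ∧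
        IsQuasiIsometric X.vdist prodDist (h.prodDiary μ κ ∘ h.prodMap)) := by
  constructor
  · have hD : 0 < Metric.diam (univ : Set Z) := by
      obtain ⟨x, y, hxy⟩ := exists_pair_ne Z
      exact (dist_pos.2 hxy).trans_le
        (Metric.dist_le_diam_of_mem hbounded (mem_univ x) (mem_univ y))
    obtain ⟨r₀, hr₀, h⟩ := (capacityProperty_of_cdim_eq hn).exists_isAdapted hC hD
    refine ⟨min r₀ (1 / 6), by positivity, fun r hr hr0 => ?_⟩
    rw [lt_min_iff] at hr0
    exact ⟨nonempty_hypApprox hr hr0.2.le hD, h r hr hr0.1,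
      exists_isProperColoring hbounded hdoubling hr⟩
  · intro r X 𝒰 h F _ μ hμ κ hκ
    have : Finite (Page κ (Letter F)) := by
      have := Fintype.ofFinite (Letter F)
      infer_instance
    exact ⟨HypApprox.graph_connected hbounded, wordTree_isTree, wordTree_neighborSet_finite,
      h.isQuasiIsometric hbounded hμ hκ⟩
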